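/- Let $\mathbb K=\mathbb R$ or $\mathbb C$ and let $(L,A)$ be a Lie pair over a smooth manifold $M$: an inclusion $i\colon A\hookrightarrow L$ of $\mathbb K$-Lie algebroids over $M$, with quotient bundle $B=L/A$. Fix a splitting of $0\to A\xrightarrow{i}L\xrightarrow{\mathrm{pr}_B}B\to0$, i.e. bundle maps $j\colon B\to L$ and $\mathrm{pr}_A\colon L\to A$ with $\mathrm{pr}_B\,j=\mathrm{id}$, $\mathrm{pr}_A\,i=\mathrm{id}$, $i\,\mathrm{pr}_A+j\,\mathrm{pr}_B=\mathrm{id}$. Let $\mathscr A$ be a local Artinian $\mathbb K$-algebra with maximal ideal $\mathfrak m$ and residue field $\mathbb K$, and let $\mathrm{ev}\colon\mathscr A\to\mathbb K$ be the evaluation. For a vector bundle $E$ put $\Gamma(E_{\mathscr A})=\Gamma(E)\otimes_{\mathbb K}\mathscr A$; the center of an $\mathscr A$-linear map $\Gamma(E_{\mathscr A})\to\Gamma(F_{\mathscr A})$ is its composition with $\mathrm{ev}$ restricted to $\Gamma(E)$. **Extended $L_\infty$-algebra.** Let $\mathfrak h=(\mathrm{Der}(L)\oplus\Gamma(B))\oplus\bigoplus_{n\ge1}\Gamma(\wedge^nA^*\otimes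 B)$ be the extended cubic $L_\infty$-algebra of $(L,A)$, where $\mathrm{Der}(L)$ is the space of Lie algebroid derivations $\delta$ of $L$ (with symbol). For $\delta\in\mathrm{Der}(L)$, $b\in\Gamma(B)$, $X,Y\in\mathfrak h^1=\Gamma(A^*\otimes B)$ and $a,a_1,a_2\in\Gamma(A)$ (viewed in $\Gamma(L)$ through $i$), its brackets are $$[\delta]_1(a)=-\mathrm{pr}_B\delta(a),\quad [\delta,X]_2(a)=\mathrm{pr}_B\delta jX(a)-X(\mathrm{pr}_A\delta(a)),\quad [\delta,X,Y]_3=Y\,\mathrm{pr}_A\delta j\,X+X\,\mathrm{pr}_A\delta j\,Y,$$ $$[b]_1(a)=\mathrm{pr}_B[a,jb],\quad [b,X]_2(a)=\mathrm{pr}_B[jb,jX(a)]-X(\mathrm{pr}_A[jb,a]),\quad [b,X,Y]_3(a)=Y(\mathrm{pr}_A[jb,jX(a)])+X(\mathrm{pr}_A[jb,jY(a)]),$$ $$[X]_1(a_1,a_2)=\mathrm{pr}_B[a_1,jX(a_2)]-\mathrm{pr}_B[a_2,jX(a_1)]-X([a_1,a_2]_A),$$ $$\tfrac1{2!}[X,X]_2(a_1,a_2)=\mathrm{pr}_B[jX(a_1),jX(a_2)]-X(\mathrm{pr}_A[jX(a_1),a_2])-X(\mathrm{pr}_A[a_1,jX(a_2)]),$$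 $$\tfrac1{3!}[X,X,X]_3(a_1,a_2)=-X(\mathrm{pr}_A[jX(a_1),jX(a_2)]),$$ the last two being polarized symmetrically. The brackets are extended $\mathscr A$-multilinearly to $\mathfrak h\otimes\mathfrak m$. A Maurer–Cartan element is $\xi\in\Gamma(A^*\otimes B)\otimes\mathfrak m$ with $[\xi]_1+\frac1{2!}[\xi,\xi]_2+\frac1{3!}[\xi,\xi,\xi]_3=0$. Maurer–Cartan elements $\xi,\eta$ are gauge equivalent if there is $b\in\mathfrak h^0\otimes\mathfrak m=(\mathrm{Der}(L)\oplus\Gamma(B))\otimes\mathfrak m$ with $$\eta=e^b*\xi:=\xi-\sum_{k\ge1}\frac1{k!}e^k_\xi(b),\qquad e^1_\xi(b)=[b]_1-[b,\xi]_2+\tfrac12[b,\xi,\xi]_3,$$ $$e^{k+1}_\xi(b)=[b,e^k_\xi(b)]_2-[b,\xi,e^k_\xi(b)]_3+\frac12\sum_{k_1+k_2=k,\ k_i\ge1}\frac{k!}{k_1!\,k_2!}[b,e^{k_1}_\xi(b),e^{k_2}_\xi(b)]_3\quad(k\ge1).$$ **Deformations.** Let $L^0_{\mathscr A}$ be the $\mathscr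 A$-linear extension of the Lie algebroid $L$. An $\mathscr A$-ringed Lie algebroid structure on $A_{\mathscr A}$ consists of an $\mathscr A$-bilinear Lie bracket on $\Gamma(A_{\mathscr A})$ and a $C^\infty(M,\mathbb K)\otimes\mathscr A$-linear anchor to $\Gamma(T_M\otimes\mathbb K)\otimes\mathscr A$ satisfying the Leibniz rule. A morphism of $\mathscr A$-ringed Lie algebroids is a pair $(\Pi,\lambda)$ of an $\mathscr A$-linear map $\Pi$ of sections and an $\mathscr A$-algebra endomorphism $\lambda$ of $C^\infty(M,\mathbb K)\otimes\mathscr A$ with center $\mathrm{id}$, such that $\Pi(fu)=\lambda(f)\Pi(u)$, $\Pi$ preserves brackets, and $\lambda\langle\rho(u),f\rangle=\langle\rho'(\Pi u),\lambda f\rangle$. A small automorphism of $L^0_{\mathscr A}$ is a morphism from $L^0_{\mathscr A}$ to itself whose center is $\mathrm{id}_L$. An infinitesimal deformation of $(L,A)$ over $\mathscr A$ is an $\mathscr A$-ringed Lie algebroid structure on $A_{\mathscr A}$ with center $A$, together with a morphism $(I,\lambda)\colon A_{\mathscr A}\to L^0_{\mathscr A}$ with center $i$. Two of them, $(I,\lambda)$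 and $(I',\lambda')$, are weakly isomorphic if there are a small automorphism $\Phi$ of $L^0_{\mathscr A}$ and a morphism $\Phi_A$ of $\mathscr A$-ringed Lie algebroids from the source of $I'$ to the source of $I$ such that $\Phi\circ I'=I\circ\Phi_A$ as morphisms (pairs). For $\xi\in\Gamma(A^*\otimes B)\otimes\mathfrak m$ let $I_\xi=i+j\xi$ (covering $\lambda=\mathrm{id}$), where $A_{\mathscr A}$ carries the bracket $\mathrm{pr}_A[I_\xi a_1,I_\xi a_2]$ and the anchor $\rho_L\circ I_\xi$. **Statement.** Let $\xi,\eta$ be Maurer–Cartan elements of $\mathfrak h\otimes\mathfrak m$. Then $I_\xi$ and $I_\eta$ are infinitesimal deformations of $(L,A)$ (the associated standard deformations), and $\xi$ and $\eta$ are gauge equivalent if and only if $I_\xi$ and $I_\eta$ are weakly isomorphic. -/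

import Mathlib

open scoped TensorProduct ContDiff Manifold Bundle

noncomputable section

namespace LiePairs

/-! ## Lie algebroids and Lie pairs in terms of sections

Throughout, `R` stands for `C^∞(M, 𝕂)` and `Γ`, `ΓA`, `ΓL`, `ΓB` for modules of sections. -/

section Algebroids

variable (𝕂 : Type*) [Field 𝕂] (R : Type*) [CommRing R] [Algebra 𝕂 R]
  (Γ : Type*) [AddCommGroup Γ] [Module 𝕂 Γ] [Module R Γ] [IsScalarTower 𝕂 R Γ]

/-- A Lie algebroid structure on a vector bundle with module of sections `Γ`: a `𝕂`-bilinear Lie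
bracket on sections and a `C^∞`-linear anchor with values in the `𝕂`-valued vector fields
`Γ(T_M ⊗ 𝕂) = Der_𝕂 C^∞(M, 𝕂)`, which is a morphism of Lie algebras and satisfies the Leibniz
identity. -/
structure LieAlgebroidStr where
  bracket : Γ →ₗ[𝕂] Γ →ₗ[𝕂] Γ
  anchor : Γ →ₗ[R] Derivation 𝕂 R R
  bracket_self : ∀ u, bracket u u = 0
  jacobi : ∀ u v w, bracket u (bracket v w) = bracket (bracket u v) w + bracket v (bracket u w)
  anchor_bracket : ∀ u v, anchor (bracket u v) = ⁅anchor u, anchor v⁆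
  leibniz : ∀ (u v : Γ) (f : R), bracket u (f • v) = anchor u f • v + f • bracket u v

variable {𝕂 R Γ}

theorem LieAlgebroidStr.skew (E : LieAlgebroidStr 𝕂 R Γ) (u v : Γ) :
    E.bracket u v = - E.bracket v u := by
  have h := E.bracket_self (u + v)
  simp only [map_add, LinearMap.add_apply, E.bracket_self, zero_add, add_zero] at h
  exact eq_neg_of_add_eq_zero_right h

theorem LieAlgebroidStr.leibniz_left (E : LieAlgebroidStr 𝕂 R Γ) (u v : Γ) (f : R) :
    E.bracket (f • u) v = f • E.bracket u v - E.anchor v f • u := by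
  rw [E.skew, E.leibniz, E.skew u v, smul_neg]; abel

/-- The space `Der(E)` of derivations of a Lie algebroid: pairs of a `𝕂`-linear operator on
sections and a vector field, its symbol. -/
def LieAlgebroidStr.Der (E : LieAlgebroidStr 𝕂 R Γ) :
    Submodule 𝕂 (Module.End 𝕂 Γ × Derivation 𝕂 R R) where
  carrier := {δ | (∀ (f : R) (u : Γ), δ.1 (f • u) = δ.2 f • u + f • δ.1 u) ∧
    (∀ u, ⁅δ.2, E.anchor u⁆ = E.anchor (δ.1 u)) ∧
    (∀ u v, δ.1 (E.bracket u v) = E.bracket (δ.1 u) v + E.bracket u (δ.1 v))}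
  add_mem' := by
    rintro δ δ' ⟨h1, h2, h3⟩ ⟨k1, k2, k3⟩
    refine ⟨fun f u => ?_, fun u => ?_, fun u v => ?_⟩
    · simp only [Prod.fst_add, Prod.snd_add, LinearMap.add_apply, Derivation.add_apply, h1, k1,
        add_smul, smul_add]
      abel
    · simp only [Prod.fst_add, Prod.snd_add, LinearMap.add_apply, map_add, add_lie, h2, k2]
    · simp only [Prod.fst_add, LinearMap.add_apply, map_add, h3, k3]
      abel
  zero_mem' := by
    refine ⟨fun f u => ?_, fun u => ?_, fun u v => ?_⟩ <;> simp
  smul_mem' := by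
    rintro c δ ⟨h1, h2, h3⟩
    refine ⟨fun f u => ?_, fun u => ?_, fun u v => ?_⟩
    · simp only [Prod.smul_fst, Prod.smul_snd, LinearMap.smul_apply, Derivation.smul_apply, h1,
        smul_add, smul_assoc]
      rw [smul_comm c f]
    · simp only [Prod.smul_fst, Prod.smul_snd, LinearMap.smul_apply, smul_lie, h2]
      rw [← algebraMap_smul R c (δ.1 u), map_smul, algebraMap_smul]
    · simp only [Prod.smul_fst, LinearMap.smul_apply, map_smul, h3, smul_add]

end Algebroids

section Pairs

variable (𝕂 : Type*) [Field 𝕂] (R : Type*) [CommRing R] [Algebra 𝕂 R]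
  (ΓA : Type*) [AddCommGroup ΓA] [Module 𝕂 ΓA] [Module R ΓA] [IsScalarTower 𝕂 R ΓA]
  (ΓL : Type*) [AddCommGroup ΓL] [Module 𝕂 ΓL] [Module R ΓL] [IsScalarTower 𝕂 R ΓL]
  (ΓB : Type*) [AddCommGroup ΓB] [Module 𝕂 ΓB] [Module R ΓB] [IsScalarTower 𝕂 R ΓB]

/-- On sections: a Lie pair `(L, A)`, i.e. an inclusion `i` of Lie algebroids, the quotient
`B = L / A` with projection `prB`, and a splitting of `0 → A → L → B → 0` given by
`j : B → L` and `prA : L → A`. -/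
structure SplitPair where
  LA : LieAlgebroidStr 𝕂 R ΓA
  LL : LieAlgebroidStr 𝕂 R ΓL
  i : ΓA →ₗ[R] ΓL
  prB : ΓL →ₗ[R] ΓB
  j : ΓB →ₗ[R] ΓL
  prA : ΓL →ₗ[R] ΓA
  prB_i : ∀ a, prB (i a) = 0
  prB_j : ∀ b, prB (j b) = b
  prA_i : ∀ a, prA (i a) = a
  decomp : ∀ l, i (prA l) + j (prB l) = l
  i_bracket : ∀ a a', i (LA.bracket a a') = LL.bracket (i a) (i a')
  i_anchor : ∀ a, LL.anchor (i a) = LA.anchor a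

variable {𝕂 R ΓA ΓL ΓB}

theorem SplitPair.prA_j (P : SplitPair 𝕂 R ΓA ΓL ΓB) (b : ΓB) : P.prA (P.j b) = 0 := by
  have h := congrArg P.prA (P.decomp (P.j b))
  simpa [P.prA_i, P.prB_j] using h

end Pairs

/-! ## Extension of scalars to an algebra `𝒜`

For a `𝕂`-vector space `X`, the space `X ⊗ 𝒜` is written `𝒜 ⊗[𝕂] X`. -/

section Extension

variable {𝕂 : Type*} [Field 𝕂] (𝒜 : Type*) [CommRing 𝒜] [Algebra 𝕂 𝒜]
  {X Y Z W : Type*} [AddCommGroup X] [Module 𝕂 X] [AddCommGroup Y] [Module 𝕂 Y]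
  [AddCommGroup Z] [Module 𝕂 Z] [AddCommGroup W] [Module 𝕂 W]

variable (X Y) in
/-- The application map `(a ⊗ φ, b ⊗ x) ↦ ab ⊗ φ x`. -/
def extApp : 𝒜 ⊗[𝕂] (X →ₗ[𝕂] Y) →ₗ[𝒜] 𝒜 ⊗[𝕂] X →ₗ[𝒜] 𝒜 ⊗[𝕂] Y :=
  (LinearMap.baseChangeHom 𝕂 𝒜 X Y).liftBaseChange 𝒜

/-- The `𝒜`-bilinear extension `(a ⊗ x, b ⊗ y) ↦ ab ⊗ β x y` of a bilinear map. -/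
def ext₂ (β : X →ₗ[𝕂] Y →ₗ[𝕂] Z) : 𝒜 ⊗[𝕂] X →ₗ[𝒜] 𝒜 ⊗[𝕂] Y →ₗ[𝒜] 𝒜 ⊗[𝕂] Z :=
  extApp 𝒜 Y Z ∘ₗ β.baseChange 𝒜

/-- The `𝒜`-trilinear extension of a trilinear map. -/
def ext₃ (τ : X →ₗ[𝕂] Y →ₗ[𝕂] Z →ₗ[𝕂] W) (x : 𝒜 ⊗[𝕂] X) (y : 𝒜 ⊗[𝕂] Y) :
    𝒜 ⊗[𝕂] Z →ₗ[𝒜] 𝒜 ⊗[𝕂] W :=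
  extApp 𝒜 Z W (ext₂ 𝒜 τ x y)

theorem ext₂_tmul (β : X →ₗ[𝕂] Y →ₗ[𝕂] Z) (a b : 𝒜) (x : X) (y : Y) :
    ext₂ 𝒜 β (a ⊗ₜ x) (b ⊗ₜ y) = (a * b) ⊗ₜ β x y := by
  simp [ext₂, extApp, TensorProduct.smul_tmul']

variable (𝕂 X) in
/-- The subspace `X ⊗ 𝔪` of `X ⊗ 𝒜`, where `𝔪` is the maximal ideal of `𝒜`. -/
def mPart [IsLocalRing 𝒜] : Submodule 𝒜 (𝒜 ⊗[𝕂] X) :=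
  IsLocalRing.maximalIdeal 𝒜 • (⊤ : Submodule 𝒜 (𝒜 ⊗[𝕂] X))

variable {𝒜} in
variable (X) in
/-- The evaluation map `X ⊗ 𝒜 → X` at the maximal ideal, for `ev : 𝒜 → 𝒜 / 𝔪 = 𝕂`. -/
def evMap (ev : 𝒜 →ₐ[𝕂] 𝕂) : 𝒜 ⊗[𝕂] X →ₗ[𝕂] X :=
  (TensorProduct.lid 𝕂 X).toLinearMap ∘ₗ ev.toLinearMap.rTensor X

variable {𝒜} in
/-- The center `ev ∘ Π : X → Y` of an `𝒜`-linear map `Π : X ⊗ 𝒜 → Y ⊗ 𝒜`. -/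
def center (ev : 𝒜 →ₐ[𝕂] 𝕂) (Φ : 𝒜 ⊗[𝕂] X →ₗ[𝒜] 𝒜 ⊗[𝕂] Y) (x : X) : Y :=
  evMap Y ev (Φ (1 ⊗ₜ x))

end Extension

/-! ## Maurer–Cartan elements and gauge equivalence for cubic `L_∞`-algebras -/

section Cubic

variable (𝕂 : Type*) [Field 𝕂]
  (g₀ g₁ g₂ : Type*) [AddCommGroup g₀] [Module 𝕂 g₀] [AddCommGroup g₁] [Module 𝕂 g₁]
  [AddCommGroup g₂] [Module 𝕂 g₂]

/-- The components of the brackets of a cubic `L_∞`-algebra `g` that enter its Maurer–Cartan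
equation and the gauge action of `g⁰` on Maurer–Cartan elements (all in degrees `0`, `1`, `2`):
`[b]₁, [b, x]₂, [b, x, y]₃ ∈ g¹` and `[x]₁, [x, y]₂, [x, y, z]₃ ∈ g²` for `b ∈ g⁰` and
`x, y, z ∈ g¹`. The space `g₂` is any space containing the component of degree `2`. -/
structure CubicBrackets where
  d₀ : g₀ →ₗ[𝕂] g₁
  br₀₁ : g₀ →ₗ[𝕂] g₁ →ₗ[𝕂] g₁
  br₀₁₁ : g₀ →ₗ[𝕂] g₁ →ₗ[𝕂] g₁ →ₗ[𝕂] g₁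
  d₁ : g₁ →ₗ[𝕂] g₂
  br₁₁ : g₁ →ₗ[𝕂] g₁ →ₗ[𝕂] g₂
  br₁₁₁ : g₁ →ₗ[𝕂] g₁ →ₗ[𝕂] g₁ →ₗ[𝕂] g₂

variable {𝕂 g₀ g₁ g₂} (C : CubicBrackets 𝕂 g₀ g₁ g₂)
  {𝒜 : Type*} [CommRing 𝒜] [Algebra 𝕂 𝒜]

/-- `ξ` is a Maurer–Cartan element of `g ⊗ 𝔪`: it is an element of `g¹ ⊗ 𝔪` with
`[ξ]₁ + [ξ, ξ]₂ / 2! + [ξ, ξ, ξ]₃ / 3! = 0`. -/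
def CubicBrackets.IsMaurerCartan [IsLocalRing 𝒜] (ξ : 𝒜 ⊗[𝕂] g₁) : Prop :=
  ξ ∈ mPart 𝕂 𝒜 g₁ ∧
    C.d₁.baseChange 𝒜 ξ + (2 : 𝕂)⁻¹ • ext₂ 𝒜 C.br₁₁ ξ ξ + (6 : 𝕂)⁻¹ • ext₃ 𝒜 C.br₁₁₁ ξ ξ ξ = 0

/-- `[b]₁^ξ = [b]₁ + [ξ, b]₂ + [ξ, ξ, b]₃ / 2`, where by graded skew-symmetry
`[ξ, b]₂ = - [b, ξ]₂` and `[ξ, ξ, b]₃ = [b, ξ, ξ]₃`. -/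
def CubicBrackets.twisted₁ (ξ : 𝒜 ⊗[𝕂] g₁) (b : 𝒜 ⊗[𝕂] g₀) : 𝒜 ⊗[𝕂] g₁ :=
  C.d₀.baseChange 𝒜 b - ext₂ 𝒜 C.br₀₁ b ξ + (2 : 𝕂)⁻¹ • ext₃ 𝒜 C.br₀₁₁ b ξ ξ

/-- `[b, x]₂^ξ = [b, x]₂ + [ξ, b, x]₃`, where `[ξ, b, x]₃ = - [b, ξ, x]₃`. -/
def CubicBrackets.twisted₂ (ξ : 𝒜 ⊗[𝕂] g₁) (b : 𝒜 ⊗[𝕂] g₀) (x : 𝒜 ⊗[𝕂] g₁) : 𝒜 ⊗[𝕂] g₁ :=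
  ext₂ 𝒜 C.br₀₁ b x - ext₃ 𝒜 C.br₀₁₁ b ξ x

/-- `[b, x, y]₃^ξ = [b, x, y]₃`. -/
def CubicBrackets.twisted₃ (b : 𝒜 ⊗[𝕂] g₀) (x y : 𝒜 ⊗[𝕂] g₁) : 𝒜 ⊗[𝕂] g₁ :=
  ext₃ 𝒜 C.br₀₁₁ b x y

/-- The elements `e^k_ξ(b)`, with the convention `e^0_ξ(b) = -ξ`. For `k ≥ 1`,
`e^{k+1}_ξ(b) = ∑ₙ (1/n!) ∑_{k₁+⋯+kₙ=k, kᵢ≥1} k!/(k₁!⋯kₙ!) [b, e^{k₁}_ξ(b), …, e^{kₙ}_ξ(b)]^ξ_{n+1}`,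
where only `n = 1, 2` contribute; in the sum below `k₁ = p + 1` and `k₂ = k + 1 - k₁`. -/
def CubicBrackets.expTerm (ξ : 𝒜 ⊗[𝕂] g₁) (b : 𝒜 ⊗[𝕂] g₀) : ℕ → 𝒜 ⊗[𝕂] g₁
  | 0 => -ξ
  | 1 => C.twisted₁ ξ b
  | k + 2 => C.twisted₂ ξ b (expTerm ξ b (k + 1)) +
      (2 : 𝕂)⁻¹ • ∑ p : Fin k, ((k + 1).choose (p + 1) : 𝕂) •
        C.twisted₃ b (expTerm ξ b (p + 1)) (expTerm ξ b (k - p))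
  termination_by k => k
  decreasing_by all_goals omega

/-- The `L_∞`-exponential `e^b * ξ = ξ - ∑_{k ≥ 1} e^k_ξ(b) / k!`; the sum is finite for
`b ∈ g⁰ ⊗ 𝔪` with `𝔪` nilpotent. -/
def CubicBrackets.expAct (b : 𝒜 ⊗[𝕂] g₀) (ξ : 𝒜 ⊗[𝕂] g₁) : 𝒜 ⊗[𝕂] g₁ :=
  ξ - ∑ᶠ k : ℕ, (((k + 1).factorial : 𝕂)⁻¹) • C.expTerm ξ b (k + 1)

/-- Gauge equivalence: `η = e^b * ξ` for some `b ∈ g⁰ ⊗ 𝔪`. -/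
def CubicBrackets.GaugeEquivalent [IsLocalRing 𝒜] (ξ η : 𝒜 ⊗[𝕂] g₁) : Prop :=
  ∃ b ∈ mPart 𝕂 𝒜 g₀, η = C.expAct b ξ

end Cubic

/-! ## The extended cubic `L_∞`-algebra of a Lie pair -/

section Extended

variable {𝕂 : Type*} [Field 𝕂] {R : Type*} [CommRing R] [Algebra 𝕂 R]
  {ΓA : Type*} [AddCommGroup ΓA] [Module 𝕂 ΓA] [Module R ΓA] [IsScalarTower 𝕂 R ΓA]
  {ΓL : Type*} [AddCommGroup ΓL] [Module 𝕂 ΓL] [Module R ΓL] [IsScalarTower 𝕂 R ΓL]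
  {ΓB : Type*} [AddCommGroup ΓB] [Module 𝕂 ΓB] [Module R ΓB] [IsScalarTower 𝕂 R ΓB]
  (P : SplitPair 𝕂 R ΓA ΓL ΓB)

namespace SplitPair

/-- `[δ]₁ = - prB ∘ δ` on `Γ(A)`, for `δ ∈ Der(L)`. -/
def derD : P.LL.Der →ₗ[𝕂] (ΓA →ₗ[R] ΓB) where
  toFun δ :=
    { toFun := fun a => - P.prB (δ.1.1 (P.i a))
      map_add' := fun a a' => by simp only [map_add, neg_add]
      map_smul' := fun f a => by
        simp only [map_smul, δ.2.1, map_add, P.prB_i, smul_zero, zero_add, smul_neg,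
          RingHom.id_apply] }
  map_add' δ δ' := by
    ext a
    simp only [Submodule.coe_add, Prod.fst_add, LinearMap.add_apply, map_add, LinearMap.coe_mk,
      AddHom.coe_mk, neg_add]
  map_smul' c δ := by
    ext a
    simp only [Submodule.coe_smul, Prod.smul_fst, LinearMap.smul_apply, LinearMap.coe_mk,
      AddHom.coe_mk, RingHom.id_apply, LinearMap.map_smul_of_tower, smul_neg]

/-- `[δ, X]₂ = (prB ∘ δ ∘ j) ∘ X - X ∘ (prA ∘ δ)`, for `δ ∈ Der(L)` and `X ∈ Ω¹_A(B)`. -/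
def derBr₂ : P.LL.Der →ₗ[𝕂] (ΓA →ₗ[R] ΓB) →ₗ[𝕂] (ΓA →ₗ[R] ΓB) :=
  LinearMap.mk₂ 𝕂
    (fun δ X =>
      { toFun := fun a => P.prB (δ.1.1 (P.j (X a))) - X (P.prA (δ.1.1 (P.i a)))
        map_add' := fun a a' => by simp only [map_add]; abel
        map_smul' := fun f a => by
          simp only [map_smul, δ.2.1, map_add, P.prB_j, P.prA_i, RingHom.id_apply, smul_sub]
          abel })
    (fun δ δ' X => by
      ext a
      simp only [Submodule.coe_add, Prod.fst_add, LinearMap.add_apply, map_add, LinearMap.coe_mk,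
        AddHom.coe_mk]
      abel)
    (fun c δ X => by
      ext a
      simp only [Submodule.coe_smul, Prod.smul_fst, LinearMap.smul_apply, LinearMap.coe_mk,
        AddHom.coe_mk, LinearMap.map_smul_of_tower, smul_sub])
    (fun δ X Y => by
      ext a
      simp only [LinearMap.add_apply, map_add, LinearMap.coe_mk, AddHom.coe_mk]
      abel)
    (fun c δ X => by
      ext a
      simp only [LinearMap.smul_apply, LinearMap.coe_mk, AddHom.coe_mk, LinearMap.map_smul_of_tower,
        smul_sub])

/-- `θ_δ = prA ∘ δ ∘ j`, which is `C^∞`-linear. -/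
def derθ : P.LL.Der →ₗ[𝕂] (ΓB →ₗ[R] ΓA) where
  toFun δ :=
    { toFun := fun b => P.prA (δ.1.1 (P.j b))
      map_add' := fun a a' => by simp only [map_add]
      map_smul' := fun f a => by
        simp only [map_smul, δ.2.1, map_add, P.prA_j, smul_zero, zero_add, RingHom.id_apply] }
  map_add' δ δ' := by ext a; simp
  map_smul' c δ := by
    ext a
    simp only [Submodule.coe_smul, Prod.smul_fst, LinearMap.smul_apply, LinearMap.coe_mk,
      AddHom.coe_mk, RingHom.id_apply, LinearMap.map_smul_of_tower]

/-- For a linear family `θ` of bundle maps `B → A`: `(X, Y) ↦ Y ∘ θ ∘ X + X ∘ θ ∘ Y`. -/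
def symComp {D : Type*} [AddCommGroup D] [Module 𝕂 D] (θ : D →ₗ[𝕂] (ΓB →ₗ[R] ΓA)) :
    D →ₗ[𝕂] (ΓA →ₗ[R] ΓB) →ₗ[𝕂] (ΓA →ₗ[R] ΓB) →ₗ[𝕂] (ΓA →ₗ[R] ΓB) :=
  LinearMap.mk₂ 𝕂
    (fun δ X =>
      { toFun := fun Y => Y ∘ₗ θ δ ∘ₗ X + X ∘ₗ θ δ ∘ₗ Y
        map_add' := fun Y Y' => by ext a; simp; abel
        map_smul' := fun c Y => by
          ext a
          simp [LinearMap.map_smul_of_tower] })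
    (fun δ δ' X => by ext Y a; simp; abel)
    (fun c δ X => by ext Y a; simp [LinearMap.map_smul_of_tower])
    (fun δ X X' => by ext Y a; simp; abel)
    (fun c δ X => by ext Y a; simp [LinearMap.map_smul_of_tower])

/-- `[b]₁ = d_CE b : a ↦ ∇_a b = prB [a, j b]`, the Bott connection, for `b ∈ Γ(B)`. -/
def secD : ΓB →ₗ[𝕂] (ΓA →ₗ[R] ΓB) where
  toFun b :=
    { toFun := fun a => P.prB (P.LL.bracket (P.i a) (P.j b))
      map_add' := fun a a' => by simp only [map_add, LinearMap.add_apply]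
      map_smul' := fun f a => by
        simp only [map_smul, P.LL.leibniz_left, map_sub, P.prB_i, smul_zero, sub_zero,
          RingHom.id_apply] }
  map_add' b b' := by ext a; simp
  map_smul' c b := by ext a; simp [LinearMap.map_smul_of_tower]

/-- `[b, X]₂ : a ↦ prB [j b, j X(a)] - X (prA [j b, a])`, for `b ∈ Γ(B)`, `X ∈ Ω¹_A(B)`. -/
def secBr₂ : ΓB →ₗ[𝕂] (ΓA →ₗ[R] ΓB) →ₗ[𝕂] (ΓA →ₗ[R] ΓB) :=
  LinearMap.mk₂ 𝕂
    (fun b X =>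
      { toFun := fun a =>
          P.prB (P.LL.bracket (P.j b) (P.j (X a))) - X (P.prA (P.LL.bracket (P.j b) (P.i a)))
        map_add' := fun a a' => by simp only [map_add]; abel
        map_smul' := fun f a => by
          simp only [map_smul, P.LL.leibniz, map_add, P.prB_j, P.prA_i, RingHom.id_apply, smul_sub]
          abel })
    (fun b b' X => by ext a; simp; abel)
    (fun c b X => by ext a; simp [LinearMap.map_smul_of_tower, smul_sub])
    (fun b X Y => by ext a; simp; abel)
    (fun c b X => by ext a; simp [LinearMap.map_smul_of_tower, smul_sub])

/-- `θ_b = prA [j b, j -]`, which is `C^∞`-linear. -/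
def secθ : ΓB →ₗ[𝕂] (ΓB →ₗ[R] ΓA) where
  toFun b :=
    { toFun := fun b' => P.prA (P.LL.bracket (P.j b) (P.j b'))
      map_add' := fun a a' => by simp only [map_add]
      map_smul' := fun f a => by
        simp only [map_smul, P.LL.leibniz, map_add, P.prA_j, smul_zero, zero_add,
          RingHom.id_apply] }
  map_add' b b' := by ext a; simp
  map_smul' c b := by ext a; simp [LinearMap.map_smul_of_tower]

/-- `[X]₁ (a₁, a₂) = prB [a₁, j X(a₂)] - prB [a₂, j X(a₁)] - X [a₁, a₂]_A`. -/
def formD : (ΓA →ₗ[R] ΓB) →ₗ[𝕂] (ΓA →ₗ[𝕂] ΓA →ₗ[𝕂] ΓB) where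
  toFun X := LinearMap.mk₂ 𝕂
    (fun a₁ a₂ => P.prB (P.LL.bracket (P.i a₁) (P.j (X a₂)))
      - P.prB (P.LL.bracket (P.i a₂) (P.j (X a₁))) - X (P.LA.bracket a₁ a₂))
    (fun _ _ _ => by simp; abel)
    (fun _ _ _ => by simp [LinearMap.map_smul_of_tower, smul_sub])
    (fun _ _ _ => by simp; abel)
    (fun _ _ _ => by simp [LinearMap.map_smul_of_tower, smul_sub])
  map_add' X Y := by ext a₁ a₂; simp; abel
  map_smul' c X := by ext a₁ a₂; simp [LinearMap.map_smul_of_tower, smul_sub]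

/-- The bilinear map `(X, Y) ↦ [(a₁, a₂) ↦ prB [j X(a₁), j Y(a₂)] - X (prA [j Y(a₁), a₂])
- X (prA [a₁, j Y(a₂)])]`, whose symmetrization is the binary bracket on `Ω¹_A(B)`. -/
def halfBr₂ : (ΓA →ₗ[R] ΓB) →ₗ[𝕂] (ΓA →ₗ[R] ΓB) →ₗ[𝕂] (ΓA →ₗ[𝕂] ΓA →ₗ[𝕂] ΓB) :=
  LinearMap.mk₂ 𝕂
    (fun X Y => LinearMap.mk₂ 𝕂
      (fun a₁ a₂ => P.prB (P.LL.bracket (P.j (X a₁)) (P.j (Y a₂)))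
        - X (P.prA (P.LL.bracket (P.j (Y a₁)) (P.i a₂)))
        - X (P.prA (P.LL.bracket (P.i a₁) (P.j (Y a₂)))))
      (fun _ _ _ => by simp; abel)
      (fun _ _ _ => by simp [LinearMap.map_smul_of_tower, smul_sub])
      (fun _ _ _ => by simp; abel)
      (fun _ _ _ => by simp [LinearMap.map_smul_of_tower, smul_sub]))
    (fun _ _ _ => by ext a₁ a₂; simp; abel)
    (fun _ _ _ => by ext a₁ a₂; simp [LinearMap.map_smul_of_tower, smul_sub])
    (fun _ _ _ => by ext a₁ a₂; simp; abel)
    (fun _ _ _ => by ext a₁ a₂; simp [LinearMap.map_smul_of_tower, smul_sub])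

/-- `[X, Y]₂` for `X, Y ∈ Ω¹_A(B)`; in particular `[X, X]₂ / 2! (a₁, a₂) =
prB [j X(a₁), j X(a₂)] - X (prA [j X(a₁), a₂]) - X (prA [a₁, j X(a₂)])`. -/
def formBr₂ : (ΓA →ₗ[R] ΓB) →ₗ[𝕂] (ΓA →ₗ[R] ΓB) →ₗ[𝕂] (ΓA →ₗ[𝕂] ΓA →ₗ[𝕂] ΓB) :=
  P.halfBr₂ + P.halfBr₂.flip

/-- The trilinear map `(X, Y, Z) ↦ [(a₁, a₂) ↦ - X (prA [j Y(a₁), j Z(a₂)])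
- X (prA [j Z(a₁), j Y(a₂)])]`, whose cyclic sum is the ternary bracket on `Ω¹_A(B)`. -/
def thirdBr₃ : (ΓA →ₗ[R] ΓB) →ₗ[𝕂] (ΓA →ₗ[R] ΓB) →ₗ[𝕂] (ΓA →ₗ[R] ΓB) →ₗ[𝕂]
    (ΓA →ₗ[𝕂] ΓA →ₗ[𝕂] ΓB) :=
  LinearMap.mk₂ 𝕂
    (fun X Y =>
      { toFun := fun Z => LinearMap.mk₂ 𝕂
          (fun a₁ a₂ => - X (P.prA (P.LL.bracket (P.j (Y a₁)) (P.j (Z a₂))))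
            - X (P.prA (P.LL.bracket (P.j (Z a₁)) (P.j (Y a₂)))))
          (fun _ _ _ => by simp; abel)
          (fun _ _ _ => by simp [LinearMap.map_smul_of_tower, smul_sub])
          (fun _ _ _ => by simp; abel)
          (fun _ _ _ => by simp [LinearMap.map_smul_of_tower, smul_sub])
        map_add' := fun _ _ => by ext a₁ a₂; simp; abel
        map_smul' := fun _ _ => by ext a₁ a₂; simp [LinearMap.map_smul_of_tower, smul_sub] })
    (fun _ _ _ => by ext Z a₁ a₂; simp; abel)
    (fun _ _ _ => by ext Z a₁ a₂; simp [smul_sub])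
    (fun _ _ _ => by ext Z a₁ a₂; simp; abel)
    (fun _ _ _ => by ext Z a₁ a₂; simp [LinearMap.map_smul_of_tower, smul_sub])

/-- `[X, Y, Z]₃` for `X, Y, Z ∈ Ω¹_A(B)`; in particular
`[X, X, X]₃ / 3! (a₁, a₂) = - X (prA [j X(a₁), j X(a₂)])`. -/
def formBr₃ : (ΓA →ₗ[R] ΓB) →ₗ[𝕂] (ΓA →ₗ[R] ΓB) →ₗ[𝕂] (ΓA →ₗ[R] ΓB) →ₗ[𝕂]
    (ΓA →ₗ[𝕂] ΓA →ₗ[𝕂] ΓB) :=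
  LinearMap.mk₂ 𝕂
    (fun X Y => P.thirdBr₃ X Y + P.thirdBr₃.flip X Y + (P.thirdBr₃.flip X).flip Y)
    (fun _ _ _ => by ext Z a₁ a₂; simp; abel)
    (fun _ _ _ => by ext Z a₁ a₂; simp)
    (fun _ _ _ => by ext Z a₁ a₂; simp; abel)
    (fun _ _ _ => by ext Z a₁ a₂; simp)

/-- The extended cubic `L_∞`-algebra `𝔥 = (Der(L) ⊕ Γ(B)) ⊕ ⨁_{n ≥ 1} Ωⁿ_A(B)` of a Lie pair, in
the degrees needed for Maurer–Cartan elements and gauge equivalence: `𝔥⁰ = Der(L) × Γ(B)`,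
`𝔥¹ = Ω¹_A(B) = Γ(A* ⊗ B) = Hom_{C^∞}(Γ(A), Γ(B))`, and `𝔥² = Ω²_A(B)` inside the space of
`𝕂`-bilinear maps `Γ(A) × Γ(A) → Γ(B)`. -/
def extended : CubicBrackets 𝕂 (P.LL.Der × ΓB) (ΓA →ₗ[R] ΓB) (ΓA →ₗ[𝕂] ΓA →ₗ[𝕂] ΓB) where
  d₀ := P.derD.coprod P.secD
  br₀₁ := P.derBr₂.coprod P.secBr₂
  br₀₁₁ := (symComp P.derθ).coprod (symComp P.secθ)
  d₁ := P.formD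
  br₁₁ := P.formBr₂
  br₁₁₁ := P.formBr₃

/-- `ξ` is a Maurer–Cartan element of `𝔥 ⊗ 𝔪`. -/
def IsMaurerCartan {𝒜 : Type*} [CommRing 𝒜] [Algebra 𝕂 𝒜] [IsLocalRing 𝒜]
    (ξ : 𝒜 ⊗[𝕂] (ΓA →ₗ[R] ΓB)) : Prop :=
  P.extended.IsMaurerCartan ξ

/-- `ξ` and `η` are gauge equivalent in `𝔥 ⊗ 𝔪`. -/
def GaugeEquivalent {𝒜 : Type*} [CommRing 𝒜] [Algebra 𝕂 𝒜] [IsLocalRing 𝒜]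
    (ξ η : 𝒜 ⊗[𝕂] (ΓA →ₗ[R] ΓB)) : Prop :=
  P.extended.GaugeEquivalent ξ η

end SplitPair

end Extended

/-! ## `𝒜`-ringed Lie algebroids and infinitesimal deformations -/

section Ringed

variable {𝕂 : Type*} [Field 𝕂] {R : Type*} [CommRing R] [Algebra 𝕂 R]
  {Γ : Type*} [AddCommGroup Γ] [Module 𝕂 Γ] [Module R Γ] [IsScalarTower 𝕂 R Γ]
  {Γ' : Type*} [AddCommGroup Γ'] [Module 𝕂 Γ'] [Module R Γ'] [IsScalarTower 𝕂 R Γ']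
  (𝒜 : Type*) [CommRing 𝒜] [Algebra 𝕂 𝒜]

/-- Multiplication of sections `u ∈ Γ ⊗ 𝒜` by functions `f ∈ C^∞(M_𝒜) = C^∞(M, 𝕂) ⊗ 𝒜`. -/
def fmul : 𝒜 ⊗[𝕂] R →ₗ[𝒜] 𝒜 ⊗[𝕂] Γ →ₗ[𝒜] 𝒜 ⊗[𝕂] Γ :=
  ext₂ 𝒜 (Algebra.lsmul 𝕂 𝕂 Γ : R →ₐ[𝕂] Module.End 𝕂 Γ).toLinearMap

variable (𝕂 R) in
/-- The action `⟨D, f⟩` of vector fields `D ∈ Γ(T_𝒜)` on functions `f ∈ C^∞(M_𝒜)`. -/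
def vact : 𝒜 ⊗[𝕂] Derivation 𝕂 R R →ₗ[𝒜] 𝒜 ⊗[𝕂] R →ₗ[𝒜] 𝒜 ⊗[𝕂] R :=
  ext₂ 𝒜
    { toFun := fun D => D.toLinearMap
      map_add' := fun _ _ => rfl
      map_smul' := fun _ _ => rfl }

variable (𝕂 R Γ) in
/-- A bracket and an anchor on the `𝒜`-ringed vector bundle with module of sections `Γ ⊗ 𝒜`. -/
structure RingedData where
  bracket : 𝒜 ⊗[𝕂] Γ →ₗ[𝒜] 𝒜 ⊗[𝕂] Γ →ₗ[𝒜] 𝒜 ⊗[𝕂] Γ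
  anchor : 𝒜 ⊗[𝕂] Γ →ₗ[𝒜] 𝒜 ⊗[𝕂] Derivation 𝕂 R R

variable {𝒜}

/-- The axioms of an `𝒜`-ringed Lie algebroid. -/
structure RingedData.IsLieAlgebroid (E : RingedData 𝕂 R Γ 𝒜) : Prop where
  anchor_fmul : ∀ (f : 𝒜 ⊗[𝕂] R) (u : 𝒜 ⊗[𝕂] Γ), E.anchor (fmul 𝒜 f u) = fmul 𝒜 f (E.anchor u)
  bracket_self : ∀ u, E.bracket u u = 0
  jacobi : ∀ u v w,
    E.bracket u (E.bracket v w) = E.bracket (E.bracket u v) w + E.bracket v (E.bracket u w)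
  leibniz : ∀ (u : 𝒜 ⊗[𝕂] Γ) (f : 𝒜 ⊗[𝕂] R) (v : 𝒜 ⊗[𝕂] Γ),
    E.bracket u (fmul 𝒜 f v) = fmul 𝒜 (vact 𝕂 R 𝒜 (E.anchor u) f) v + fmul 𝒜 f (E.bracket u v)

/-- The Lie algebroid `E` is the center of the `𝒜`-ringed Lie algebroid `E𝒜`. -/
def RingedData.HasCenter (ev : 𝒜 →ₐ[𝕂] 𝕂) (E𝒜 : RingedData 𝕂 R Γ 𝒜)
    (E : LieAlgebroidStr 𝕂 R Γ) : Prop :=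
  (∀ u v : Γ, evMap Γ ev (E𝒜.bracket (1 ⊗ₜ u) (1 ⊗ₜ v)) = E.bracket u v) ∧
    ∀ u : Γ, evMap (Derivation 𝕂 R R) ev (E𝒜.anchor (1 ⊗ₜ u)) = E.anchor u

variable (𝒜) in
/-- The `𝒜`-Cartesian extension of a Lie algebroid: bracket and anchor are extended
`𝒜`-linearly. -/
def LieAlgebroidStr.cartesian (E : LieAlgebroidStr 𝕂 R Γ) : RingedData 𝕂 R Γ 𝒜 where
  bracket := ext₂ 𝒜 E.bracket
  anchor := (E.anchor.restrictScalars 𝕂).baseChange 𝒜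

/-- A small automorphism `λ^*` of `M_𝒜`: an `𝒜`-algebra map lifting the identity of
`C^∞(M, 𝕂)`. -/
def IsSmall (ev : 𝒜 →ₐ[𝕂] 𝕂) (lam : 𝒜 ⊗[𝕂] R →ₐ[𝒜] 𝒜 ⊗[𝕂] R) : Prop :=
  ∀ f : R, evMap R ev (lam (1 ⊗ₜ f)) = f

/-- `(Φ, lam)` is a morphism of `𝒜`-ringed Lie algebroids from `E` to `E'` over `M_𝒜`. That the
center of `Φ` is `C^∞(M, 𝕂)`-linear, i.e. a map of vector bundles, is a consequence of
`map_fmul`. -/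
structure IsRingedHom (ev : 𝒜 →ₐ[𝕂] 𝕂) (E : RingedData 𝕂 R Γ 𝒜) (E' : RingedData 𝕂 R Γ' 𝒜)
    (Φ : 𝒜 ⊗[𝕂] Γ →ₗ[𝒜] 𝒜 ⊗[𝕂] Γ') (lam : 𝒜 ⊗[𝕂] R →ₐ[𝒜] 𝒜 ⊗[𝕂] R) : Prop where
  small : IsSmall ev lam
  map_fmul : ∀ (f : 𝒜 ⊗[𝕂] R) (u : 𝒜 ⊗[𝕂] Γ), Φ (fmul 𝒜 f u) = fmul 𝒜 (lam f) (Φ u)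
  map_bracket : ∀ u v, Φ (E.bracket u v) = E'.bracket (Φ u) (Φ v)
  map_anchor : ∀ (u : 𝒜 ⊗[𝕂] Γ) (f : 𝒜 ⊗[𝕂] R),
    lam (vact 𝕂 R 𝒜 (E.anchor u) f) = vact 𝕂 R 𝒜 (E'.anchor (Φ u)) (lam f)

/-- `(Φ, lam)` is a small automorphism of the `𝒜`-Cartesian extension of a Lie algebroid: a
morphism from it to itself whose center is the identity. -/
def LieAlgebroidStr.IsSmallAut (E : LieAlgebroidStr 𝕂 R Γ) (ev : 𝒜 →ₐ[𝕂] 𝕂)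
    (Φ : 𝒜 ⊗[𝕂] Γ →ₗ[𝒜] 𝒜 ⊗[𝕂] Γ) (lam : 𝒜 ⊗[𝕂] R →ₐ[𝒜] 𝒜 ⊗[𝕂] R) : Prop :=
  IsRingedHom ev (E.cartesian 𝒜) (E.cartesian 𝒜) Φ lam ∧ ∀ u : Γ, center ev Φ u = u

variable {ΓA : Type*} [AddCommGroup ΓA] [Module 𝕂 ΓA] [Module R ΓA] [IsScalarTower 𝕂 R ΓA]
  {ΓL : Type*} [AddCommGroup ΓL] [Module 𝕂 ΓL] [Module R ΓL] [IsScalarTower 𝕂 R ΓL]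
  {ΓB : Type*} [AddCommGroup ΓB] [Module 𝕂 ΓB] [Module R ΓB] [IsScalarTower 𝕂 R ΓB]

variable (𝕂 R 𝒜 ΓA ΓL) in
/-- The data `([-,-]_{A_𝒜}, ρ_{A_𝒜}; I, λ^*)` of an infinitesimal deformation. -/
structure DeformationData where
  str : RingedData 𝕂 R ΓA 𝒜
  I : 𝒜 ⊗[𝕂] ΓA →ₗ[𝒜] 𝒜 ⊗[𝕂] ΓL
  lam : 𝒜 ⊗[𝕂] R →ₐ[𝒜] 𝒜 ⊗[𝕂] R

variable (P : SplitPair 𝕂 R ΓA ΓL ΓB) (ev : 𝒜 →ₐ[𝕂] 𝕂)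

/-- The data `D` is an infinitesimal deformation of the Lie pair `(L, A)`. -/
structure SplitPair.IsInfinitesimalDeformation (D : DeformationData 𝕂 R 𝒜 ΓA ΓL) : Prop where
  isLieAlgebroid : D.str.IsLieAlgebroid
  hasCenter : D.str.HasCenter ev P.LA
  isHom : IsRingedHom ev D.str (P.LL.cartesian 𝒜) D.I D.lam
  center_I : ∀ a : ΓA, center ev D.I a = P.i a

/-- Two infinitesimal deformations `D = (I, λ^*)` and `D' = (I', λ'^*)` are weakly isomorphic:
there are a small automorphism `(Φ, μ)` of `L⁰_𝒜` and a morphism `(ΦA, μA)` of `𝒜`-ringed Lie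
algebroids from the source of `I'` to the source of `I` with
`(Φ, μ) ∘ (I', λ'^*) = (I, λ^*) ∘ (ΦA, μA)`. -/
def SplitPair.WeaklyIsomorphic (D D' : DeformationData 𝕂 R 𝒜 ΓA ΓL) : Prop :=
  ∃ Φ μ, P.LL.IsSmallAut ev Φ μ ∧
    ∃ ΦA μA, IsRingedHom ev D'.str D.str ΦA μA ∧
      Φ ∘ₗ D'.I = D.I ∘ₗ ΦA ∧ μ.comp D'.lam = D.lam.comp μA

/-- `ξ ∈ Γ(A* ⊗ B) ⊗ 𝒜` as an `𝒜`-linear map `Γ(A_𝒜) → Γ(B_𝒜)`. -/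
def formOp (ξ : 𝒜 ⊗[𝕂] (ΓA →ₗ[R] ΓB)) : 𝒜 ⊗[𝕂] ΓA →ₗ[𝒜] 𝒜 ⊗[𝕂] ΓB :=
  extApp 𝒜 ΓA ΓB ((LinearMap.restrictScalarsₗ 𝕂 R ΓA ΓB 𝕂).baseChange 𝒜 ξ)

/-- The map `I_ξ(a) = i(a) + j(ξ(a))`. -/
def SplitPair.graphMap (ξ : 𝒜 ⊗[𝕂] (ΓA →ₗ[R] ΓB)) : 𝒜 ⊗[𝕂] ΓA →ₗ[𝒜] 𝒜 ⊗[𝕂] ΓL :=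
  (P.i.restrictScalars 𝕂).baseChange 𝒜 + (P.j.restrictScalars 𝕂).baseChange 𝒜 ∘ₗ formOp ξ

/-- The data `([-,-]^ξ, ρ^ξ; I_ξ, id)` of the standard deformation given by `ξ`, where
`[a₁, a₂]^ξ = prA [I_ξ(a₁), I_ξ(a₂)]` and `ρ^ξ(a) = ρ_L(I_ξ(a))`. -/
def SplitPair.standard (ξ : 𝒜 ⊗[𝕂] (ΓA →ₗ[R] ΓB)) : DeformationData 𝕂 R 𝒜 ΓA ΓL where
  str :=
    { bracket := (((P.LL.cartesian 𝒜).bracket).compl₁₂ (P.graphMap ξ) (P.graphMap ξ)).compr₂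
        ((P.prA.restrictScalars 𝕂).baseChange 𝒜)
      anchor := (P.LL.cartesian 𝒜).anchor ∘ₗ P.graphMap ξ }
  I := P.graphMap ξ
  lam := AlgHom.id 𝒜 (𝒜 ⊗[𝕂] R)

end Ringed

/-! ## Smooth functions, sections and bundle maps over the field `𝕂 = ℝ` or `ℂ` -/

section Geometry

variable (𝕂 : Type*) [RCLike 𝕂]
  {E : Type*} [NormedAddCommGroup E] [NormedSpace ℝ E]
  {H : Type*} [TopologicalSpace H] (I : ModelWithCorners ℝ E H)
  (M : Type*) [TopologicalSpace M] [ChartedSpace H M]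

/-- The `𝕂`-algebra `C^∞(M, 𝕂)` of smooth `𝕂`-valued functions on `M`. -/
def SmoothFun : Subalgebra 𝕂 (M → 𝕂) where
  carrier := {f | ContMDiff I 𝓘(ℝ, 𝕂) ∞ f}
  mul_mem' hf hg :=
    (contDiff_mul (𝕜 := ℝ) (𝔸 := 𝕂)).comp_contMDiff (ContMDiff.prodMk_space hf hg)
  add_mem' hf hg := ContMDiff.add hf hg
  algebraMap_mem' _ := contMDiff_const

variable {M}
variable (F : Type*) [NormedAddCommGroup F] [NormedSpace 𝕂 F] [NormedSpace ℝ F]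
  [IsScalarTower ℝ 𝕂 F]
  (V : M → Type*) [∀ x, AddCommGroup (V x)] [∀ x, Module 𝕂 (V x)] [∀ x, Module ℝ (V x)]
  [∀ x, TopologicalSpace (V x)] [TopologicalSpace (Bundle.TotalSpace F V)]
  [FiberBundle F V] [VectorBundle 𝕂 F V] [VectorBundle ℝ F V]

/-- The module `Γ(V)` of smooth sections of a `𝕂`-vector bundle `V`, over the ring
`C^∞(M, 𝕂)` acting pointwise. Smoothness is over `ℝ`. -/
def Sections : Submodule (SmoothFun 𝕂 I M) (Π x, V x) where
  carrier := {s | ContMDiff I (I.prod 𝓘(ℝ, F)) ∞ (fun x => (⟨x, s x⟩ : Bundle.TotalSpace F V))}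
  add_mem' hs ht := ContMDiff.add_section hs ht
  zero_mem' := Bundle.contMDiff_zeroSection ℝ V
  smul_mem' := by
    intro f s hs x₀
    have h1 := hs x₀
    rw [Bundle.contMDiffAt_section] at h1 ⊢
    have h2 : ContMDiffAt I 𝓘(ℝ, 𝕂) ∞ (f : M → 𝕂) x₀ := f.2 x₀
    set e := trivializationAt F V x₀
    have h3 : ContDiff ℝ ∞ (fun p : 𝕂 × F => p.1 • p.2) :=
      (isBoundedBilinearMap_smul (𝕜 := ℝ) (A := 𝕂) (E := F)).contDiff
    refine (h3.comp_contMDiffAt (ContMDiffAt.prodMk_space h2 h1)).congr_of_eventuallyEq ?_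
    filter_upwards [e.open_baseSet.mem_nhds
      (FiberBundle.mem_baseSet_trivializationAt F V x₀)] with x hx
    exact (e.linear 𝕂 hx).2 _ _

/-- The space of sections `Γ(V)` as a type. -/
def Sec : Type _ := Sections 𝕂 I F V

instance : AddCommGroup (Sec 𝕂 I F V) := inferInstanceAs (AddCommGroup (Sections 𝕂 I F V))

instance : Module (SmoothFun 𝕂 I M) (Sec 𝕂 I F V) :=
  inferInstanceAs (Module (SmoothFun 𝕂 I M) (Sections 𝕂 I F V))

instance : Module 𝕂 (Sec 𝕂 I F V) :=
  Module.compHom (Sec 𝕂 I F V) (algebraMap 𝕂 (SmoothFun 𝕂 I M))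

instance : IsScalarTower 𝕂 (SmoothFun 𝕂 I M) (Sec 𝕂 I F V) :=
  IsScalarTower.of_algebraMap_smul (fun _ _ => rfl)

variable {V}
variable {F' : Type*} [NormedAddCommGroup F'] [NormedSpace 𝕂 F'] [NormedSpace ℝ F']
  [IsScalarTower ℝ 𝕂 F']
  {V' : M → Type*} [∀ x, AddCommGroup (V' x)] [∀ x, Module 𝕂 (V' x)] [∀ x, Module ℝ (V' x)]
  [∀ x, TopologicalSpace (V' x)] [TopologicalSpace (Bundle.TotalSpace F' V')]
  [FiberBundle F' V'] [VectorBundle 𝕂 F' V'] [VectorBundle ℝ F' V']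

variable (V V' F') in
/-- A (smooth, fibrewise `𝕂`-linear) map of vector bundles over the identity of `M`. -/
structure BundleHom where
  /-- the maps on fibres -/
  fib : ∀ x, V x →ₗ[𝕂] V' x
  smooth : ContMDiff (I.prod 𝓘(ℝ, F)) (I.prod 𝓘(ℝ, F')) ∞
    (fun p : Bundle.TotalSpace F V => (⟨p.1, fib p.1 p.2⟩ : Bundle.TotalSpace F' V'))

/-- The `C^∞(M, 𝕂)`-linear map on sections induced by a bundle map. -/
def BundleHom.onSections {𝕂 : Type*} [RCLike 𝕂] {I : ModelWithCorners ℝ E H}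
    {F : Type*} [NormedAddCommGroup F] [NormedSpace 𝕂 F] [NormedSpace ℝ F] [IsScalarTower ℝ 𝕂 F]
    {V : M → Type*} [∀ x, AddCommGroup (V x)] [∀ x, Module 𝕂 (V x)] [∀ x, Module ℝ (V x)]
    [∀ x, TopologicalSpace (V x)] [TopologicalSpace (Bundle.TotalSpace F V)]
    [FiberBundle F V] [VectorBundle 𝕂 F V] [VectorBundle ℝ F V]
    {F' : Type*} [NormedAddCommGroup F'] [NormedSpace 𝕂 F'] [NormedSpace ℝ F']
    [IsScalarTower ℝ 𝕂 F']
    {V' : M → Type*} [∀ x, AddCommGroup (V' x)] [∀ x, Module 𝕂 (V' x)] [∀ x, Module ℝ (V' x)]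
    [∀ x, TopologicalSpace (V' x)] [TopologicalSpace (Bundle.TotalSpace F' V')]
    [FiberBundle F' V'] [VectorBundle 𝕂 F' V'] [VectorBundle ℝ F' V']
    (φ : BundleHom 𝕂 I F V F' V') :
    Sec 𝕂 I F V →ₗ[SmoothFun 𝕂 I M] Sec 𝕂 I F' V' where
  toFun s := ⟨fun x => φ.fib x (s.1 x), φ.smooth.comp s.2⟩
  map_add' s t := Subtype.ext (funext fun x => map_add (φ.fib x) (s.1 x) (t.1 x))
  map_smul' f s := Subtype.ext (funext fun x => map_smul (φ.fib x) (f.1 x) (s.1 x))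

end Geometry

/-! ## Lie pairs of vector bundles -/

section GeometricPairs

variable {𝕂 : Type*} [RCLike 𝕂]
  {E : Type*} [NormedAddCommGroup E] [NormedSpace ℝ E]
  {H : Type*} [TopologicalSpace H] (I : ModelWithCorners ℝ E H)
  {M : Type*} [TopologicalSpace M] [ChartedSpace H M]
  (FA : Type*) [NormedAddCommGroup FA] [NormedSpace 𝕂 FA] [NormedSpace ℝ FA] [IsScalarTower ℝ 𝕂 FA]
  (A : M → Type*) [∀ x, AddCommGroup (A x)] [∀ x, Module 𝕂 (A x)] [∀ x, Module ℝ (A x)]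
  [∀ x, TopologicalSpace (A x)] [TopologicalSpace (Bundle.TotalSpace FA A)]
  [FiberBundle FA A] [VectorBundle 𝕂 FA A] [VectorBundle ℝ FA A]
  (FL : Type*) [NormedAddCommGroup FL] [NormedSpace 𝕂 FL] [NormedSpace ℝ FL] [IsScalarTower ℝ 𝕂 FL]
  (L : M → Type*) [∀ x, AddCommGroup (L x)] [∀ x, Module 𝕂 (L x)] [∀ x, Module ℝ (L x)]
  [∀ x, TopologicalSpace (L x)] [TopologicalSpace (Bundle.TotalSpace FL L)]
  [FiberBundle FL L] [VectorBundle 𝕂 FL L] [VectorBundle ℝ FL L]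
  (FB : Type*) [NormedAddCommGroup FB] [NormedSpace 𝕂 FB] [NormedSpace ℝ FB] [IsScalarTower ℝ 𝕂 FB]
  (B : M → Type*) [∀ x, AddCommGroup (B x)] [∀ x, Module 𝕂 (B x)] [∀ x, Module ℝ (B x)]
  [∀ x, TopologicalSpace (B x)] [TopologicalSpace (Bundle.TotalSpace FB B)]
  [FiberBundle FB B] [VectorBundle 𝕂 FB B] [VectorBundle ℝ FB B]

variable (𝕂) in
/-- A Lie pair `(L, A)` of `𝕂`-Lie algebroids over `M` together with a splitting: an injective
bundle map `i : A → L` that is a morphism of Lie algebroids, the quotient bundle `prB : L → B`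
(any model of `L / A`), and a splitting `j : B → L`, `prA : L → A` of the exact sequence
`0 → A → L → B → 0` of vector bundles. -/
structure LiePair where
  strA : LieAlgebroidStr 𝕂 (SmoothFun 𝕂 I M) (Sec 𝕂 I FA A)
  strL : LieAlgebroidStr 𝕂 (SmoothFun 𝕂 I M) (Sec 𝕂 I FL L)
  i : BundleHom 𝕂 I FA A FL L
  prB : BundleHom 𝕂 I FL L FB B
  j : BundleHom 𝕂 I FB B FL L
  prA : BundleHom 𝕂 I FL L FA A
  prB_i : ∀ x a, prB.fib x (i.fib x a) = 0
  prB_j : ∀ x b, prB.fib x (j.fib x b) = b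
  prA_i : ∀ x a, prA.fib x (i.fib x a) = a
  decomp : ∀ x l, i.fib x (prA.fib x l) + j.fib x (prB.fib x l) = l
  i_bracket : ∀ a a', i.onSections (strA.bracket a a') =
    strL.bracket (i.onSections a) (i.onSections a')
  i_anchor : ∀ a, strL.anchor (i.onSections a) = strA.anchor a

variable {I FA A FL L FB B}

/-- The Lie pair at the level of global sections. -/
def LiePair.sections (P : LiePair 𝕂 I FA A FL L FB B) :
    SplitPair 𝕂 (SmoothFun 𝕂 I M) (Sec 𝕂 I FA A) (Sec 𝕂 I FL L) (Sec 𝕂 I FB B) where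
  LA := P.strA
  LL := P.strL
  i := P.i.onSections
  prB := P.prB.onSections
  j := P.j.onSections
  prA := P.prA.onSections
  prB_i a := Subtype.ext (funext fun x => P.prB_i x (a.1 x))
  prB_j b := Subtype.ext (funext fun x => P.prB_j x (b.1 x))
  prA_i a := Subtype.ext (funext fun x => P.prA_i x (a.1 x))
  decomp l := Subtype.ext (funext fun x => P.decomp x (l.1 x))
  i_bracket := P.i_bracket
  i_anchor := P.i_anchor

end GeometricPairs

end LiePairs

end

set_option linter.unusedSectionVars false

noncomputable section

namespace LiePairs

/-! ## Exponentials and logarithms of nilpotent elements -/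

section ExpLog

variable {S : Type*} [Ring S] [Module ℚ S]

/-! Both relations say that a small automorphism of `L⁰_𝒜` carries one graph to the other.

An element `(δ, b)` of `Der(L) ⊕ Γ(B)` acts on `L` through the single derivation `D = δ + [j b, -]`,
and its brackets with forms are built from the blocks of `D` for the splitting `L = A ⊕ B`. Let `p =
i prA` and `q = j prB`, and read a form `X` as the endomorphism `j X prA` of `Γ(L_𝒜)`. Then the
elements `-e^k_ξ(b)`, starting with `ξ` for `k = 0`, are the Taylor coefficients at `t = 0` of the
solution of the Riccati equation `x' = (q - x) D (p + x)`, `x(0) = ξ`, and `e^b * ξ = x(1)`. This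
equation expresses that the flow `exp (t D)` transports the graph of `ξ` to the graph of `x(t)`;
hence `exp D` maps the graph of `ξ` into the graph of `e^b * ξ` (`exp_mul_graph`,
`exp_gaugeOp_graphMap`).

Small automorphisms are exactly the exponentials of derivations with zero center. Since `𝔪` is
nilpotent, an operator whose center is the identity is unipotent and has a logarithm
(`exists_exp_eq_one_add`). Compatibility of exponentials with a bilinear operation is equivalent to
the Leibniz rule for their logarithms (`exp_bilinear_iff`), and coordinates in a basis of `𝒜` show
that every derivation of `L⁰_𝒜` comes from `Der(L) ⊗ 𝒜` (`IsExtDer.exists_eq`).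

The Maurer–Cartan equation says that the graph of `ξ` is closed under the bracket
(`IsMaurerCartan.graphMap_bracket`), so `A_𝒜` inherits its structure from the graph. If `Φ` maps the
graph of `η` into that of `ξ`, the induced map `prA Φ I_η` of `A_𝒜` is then automatically a
morphism, which makes the relation a weak isomorphism. -/

theorem exists_exp_eq_one_add_add_sq_mul {a : S} (ha : IsNilpotent a) :
    ∃ c : S, (∀ y, Commute a y → Commute c y) ∧ IsNilpotent.exp a = 1 + a + a ^ 2 * c := by
  obtain ⟨k, hk⟩ := ha
  refine ⟨∑ i ∈ Finset.range k, ((i + 2).factorial : ℚ)⁻¹ • a ^ i, fun y hy => ?_, ?_⟩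
  · exact Commute.sum_left _ _ _ fun i _ => (hy.pow_left i).smul_left _
  · rw [IsNilpotent.exp_eq_sum (k := k + 2) (by rw [pow_add, hk, zero_mul]),
      Finset.sum_range_succ', Finset.sum_range_succ', Finset.mul_sum]
    simp only [mul_smul_comm, ← pow_add]
    simp only [add_comm 2, add_assoc, Nat.reduceAdd, zero_add, Nat.factorial_zero, Nat.factorial_one,
      Nat.cast_one, inv_one, pow_zero, pow_one, one_smul]
    abel

/-- A logarithm without its series: multiplying `1 + a` by `exp (-a)` leaves `1 + a ^ 2 * d`, whose
nilpotent part has a smaller nilpotency bound, so induction applies and the commuting exponents add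
up. The form `a * c` is what later gives the logarithm of a small automorphism zero center. -/
theorem exists_exp_eq_one_add {a : S} (ha : IsNilpotent a) :
    ∃ c : S, (∀ y, Commute a y → Commute c y) ∧ IsNilpotent.exp (a * c) = 1 + a := by
  obtain ⟨k, hk⟩ := ha
  replace hk : a ^ (k + 1) = 0 := by rw [pow_succ, hk, zero_mul]
  induction k using Nat.strong_induction_on generalizing a with
  | _ k ih =>
    rcases Nat.eq_zero_or_pos k with rfl | hpos
    · refine ⟨1, fun y _ => Commute.one_left y, ?_⟩
      have : a = 0 := by simpa using hk
      simp [this]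
    · have hnil : IsNilpotent a := ⟨_, hk⟩
      obtain ⟨c, hc, he⟩ := exists_exp_eq_one_add_add_sq_mul hnil.neg
      have hca : Commute c a := hc a (Commute.neg_left rfl)
      -- From `(1 - a + a ^ 2 * c) * (1 + a) = 1 + a ^ 2 * (c - 1 + a * c)`.
      set d : S := c - 1 + a * c with hd
      have hdc : ∀ y, Commute a y → Commute d y := fun y hy =>
        ((hc y hy.neg_left).sub_left (Commute.one_left y)).add_left
          (hy.mul_left (hc y hy.neg_left))
      have hda : Commute a d := (hdc a rfl).symm
      have hprod : IsNilpotent.exp (-a) * (1 + a) = 1 + a ^ 2 * d := by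
        rw [he, hd]
        have h1 : c * a = a * c := hca.eq
        have h2 : a ^ 2 * c * a = a ^ 2 * (a * c) := by rw [mul_assoc, h1]
        simp only [neg_sq, add_mul, mul_add, mul_sub, mul_one, one_mul, h2]
        rw [neg_mul, ← sq]
        abel
      -- The bound drops from `k + 1` to `k`, because `k + 1 ≤ 2 * k` for `k ≥ 1`.
      have hsq : (a ^ 2 * d) ^ ((k - 1) + 1) = 0 := by
        rw [(hda.pow_left 2).mul_pow, ← pow_mul,
          pow_eq_zero_of_le (by omega : k + 1 ≤ 2 * (k - 1 + 1)) hk, zero_mul]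
      obtain ⟨c', hc', he'⟩ := ih (k - 1) (by omega) hsq
      have hcomm : ∀ y, Commute a y → Commute (a ^ 2 * d) y := fun y hy =>
        (hy.pow_left 2).mul_left (hdc y hy)
      refine ⟨1 + a * d * c', fun y hy => ?_, ?_⟩
      · exact (Commute.one_left y).add_left
          ((hy.mul_left (hdc y hy)).mul_left (hc' y (hcomm y hy)))
      · have hac' : Commute a (a ^ 2 * d * c') :=
          (((Commute.refl a).pow_right 2).mul_right hda).mul_right (hc' a (hcomm a rfl)).symm
        have hn2 : IsNilpotent (a ^ 2 * d * c') :=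
          (hc' _ (Commute.refl _)).symm.isNilpotent_mul_right ⟨_, hsq⟩
        have : a * (1 + a * d * c') = a + a ^ 2 * d * c' := by
          simp only [mul_add, mul_one, sq, mul_assoc]
        rw [this, IsNilpotent.exp_add_of_commute hac' hnil hn2, he', ← hprod, ← mul_assoc,
          IsNilpotent.exp_mul_exp_neg_self hnil, one_mul]

end ExpLog

/-! ### Passing from relations between exponentials to relations between their exponents -/

section ExpIntertwine

variable {𝒜 : Type*} [CommRing 𝒜] {X Y Z : Type*} [AddCommGroup X] [Module 𝒜 X] [Module ℚ X]
  [AddCommGroup Y] [Module 𝒜 Y] [Module ℚ Y] [AddCommGroup Z] [Module 𝒜 Z] [Module ℚ Z]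

/-- `exp N - 1` factors as `(1 + N * c) * N`, and `1 + N * c` is a unit because `N * c` is
nilpotent. -/
theorem apply_eq_zero_of_exp_apply_eq {N : Module.End 𝒜 X} (hN : IsNilpotent N) {v : X}
    (h : IsNilpotent.exp N v = v) : N v = 0 := by
  obtain ⟨c, hc, he⟩ := exists_exp_eq_one_add_add_sq_mul hN
  have hNc : Commute N c := (hc N rfl).symm
  have h1 : (1 + N * c) * N = N + N ^ 2 * c := by
    rw [add_mul, one_mul, mul_assoc, (hc N rfl).eq, ← mul_assoc, sq]
  have h2 : (1 + N * c) (N v) = 0 := by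
    have := congrArg (fun f : Module.End 𝒜 X => f v) h1
    rw [he] at h
    simp only [LinearMap.add_apply, Module.End.mul_apply, Module.End.one_apply] at this h ⊢
    rw [this]
    rw [add_assoc] at h
    exact left_eq_add.mp h.symm
  have hu : IsUnit (1 + N * c) := (hNc.isNilpotent_mul_right hN).isUnit_one_add
  obtain ⟨u, hu⟩ := hu.exists_left_inv
  simpa [h2, eq_comm] using congrArg (fun f : Module.End 𝒜 X => f (N v)) hu

/-- Composition with `g` on the left and with `f` on the right are commuting nilpotent operators on
`X →ₗ[𝒜] Y`. The exponential of their difference sends `h` to `exp g ∘ h ∘ exp (-f)`, so `H` makes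
`h` a fixed vector and the difference kills it. -/
theorem comp_eq_comp_of_exp_comp_eq {f : Module.End 𝒜 X} {g : Module.End 𝒜 Y} {h : X →ₗ[𝒜] Y}
    (hf : IsNilpotent f) (hg : IsNilpotent g)
    (H : IsNilpotent.exp g ∘ₗ h = h ∘ₗ IsNilpotent.exp f) : g ∘ₗ h = h ∘ₗ f := by
  let Lg : Module.End 𝒜 (X →ₗ[𝒜] Y) := LinearMap.llcomp 𝒜 X Y Y g
  let Rf : Module.End 𝒜 (X →ₗ[𝒜] Y) := LinearMap.lcomp 𝒜 Y f
  have hLg : ∀ n k, (Lg ^ n) k = (g ^ n) ∘ₗ k := by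
    intro n
    induction n with
    | zero => intro k; rfl
    | succ n ih => intro k; rw [pow_succ', pow_succ', Module.End.mul_apply, ih]; rfl
  have hRf : ∀ n k, (Rf ^ n) k = k ∘ₗ (f ^ n) := by
    intro n
    induction n with
    | zero => intro k; rfl
    | succ n ih => intro k; rw [pow_succ', pow_succ, Module.End.mul_apply, ih]; rfl
  obtain ⟨m, hm⟩ := hf
  obtain ⟨n, hn⟩ := hg
  have hLn : Lg ^ n = 0 := by ext1 k; rw [hLg, hn]; rfl
  have hRm : Rf ^ m = 0 := by ext1 k; rw [hRf, hm, LinearMap.comp_zero]; rfl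
  have hexpL : ∀ k, IsNilpotent.exp Lg k = IsNilpotent.exp g ∘ₗ k := by
    intro k
    ext x
    simp [IsNilpotent.exp_eq_sum hLn, IsNilpotent.exp_eq_sum hn, hLg]
  have hexpR : ∀ k, IsNilpotent.exp Rf k = k ∘ₗ IsNilpotent.exp f := by
    intro k
    ext x
    simp [IsNilpotent.exp_eq_sum hRm, IsNilpotent.exp_eq_sum hm, hRf, map_rat_smul]
  have hcomm : Commute Lg Rf := by ext; rfl
  have hL : IsNilpotent Lg := ⟨n, hLn⟩
  have hR : IsNilpotent Rf := ⟨m, hRm⟩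
  have h0 : (Lg - Rf) h = 0 := by
    refine apply_eq_zero_of_exp_apply_eq (hcomm.isNilpotent_sub hL hR) ?_
    rw [sub_eq_neg_add, IsNilpotent.exp_add_of_commute hcomm.symm.neg_left hR.neg hL,
      Module.End.mul_apply, hexpL, H, ← hexpR, ← Module.End.mul_apply,
      IsNilpotent.exp_neg_mul_exp_self hR, Module.End.one_apply]
  exact sub_eq_zero.mp h0

/-- Nilpotent endomorphisms `f, g, h` satisfy the Leibniz rule for a bilinear map `β` if and only
if their exponentials are compatible with `β`. -/
theorem exp_bilinear_iff (β : X →ₗ[𝒜] Y →ₗ[𝒜] Z) {f : Module.End 𝒜 X} {g : Module.End 𝒜 Y}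
    {h : Module.End 𝒜 Z} (hf : IsNilpotent f) (hg : IsNilpotent g) (hh : IsNilpotent h) :
    (∀ x y, IsNilpotent.exp h (β x y) = β (IsNilpotent.exp f x) (IsNilpotent.exp g y)) ↔
      ∀ x y, h (β x y) = β (f x) y + β x (g y) := by
  -- The Leibniz rule says that the linearization of `β` intertwines `f ⊗ 1 + 1 ⊗ g` with `h`. The
  -- two summands commute, so the exponential of the sum is `exp f ⊗ exp g`.
  let F : Module.End 𝒜 (X ⊗[𝒜] Y) := f.rTensor Y
  let G : Module.End 𝒜 (X ⊗[𝒜] Y) := g.lTensor X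
  have hF : IsNilpotent F := hf.map (Module.End.rTensorAlgHom 𝒜 X Y)
  have hG : IsNilpotent G := hg.map (Module.End.lTensorAlgHom 𝒜 Y X)
  have hcomm : Commute F G := by ext; simp [F, G]
  have hexp : IsNilpotent.exp (F + G) =
      (IsNilpotent.exp f).rTensor Y * (IsNilpotent.exp g).lTensor X := by
    rw [IsNilpotent.exp_add_of_commute hcomm hF hG]
    congr 1
    · exact (hf.map_exp (Module.End.rTensorAlgHom 𝒜 X Y)).symm
    · exact (hg.map_exp (Module.End.lTensorAlgHom 𝒜 Y X)).symm
  let b := TensorProduct.lift β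
  have key : IsNilpotent.exp h ∘ₗ b = b ∘ₗ IsNilpotent.exp (F + G) ↔ h ∘ₗ b = b ∘ₗ (F + G) :=
    ⟨comp_eq_comp_of_exp_comp_eq (hcomm.isNilpotent_add hF hG) hh,
      Module.End.commute_exp_left_of_commute (hcomm.isNilpotent_add hF hG) hh⟩
  rw [hexp] at key
  constructor
  · intro H x y
    have := key.1 (by ext x y; simpa [b] using H x y)
    simpa [b, F, G] using LinearMap.congr_fun this (x ⊗ₜ y)
  · intro H x y
    have := key.2 (by ext x y; simpa [b, F, G] using H x y)
    simpa [b] using LinearMap.congr_fun this (x ⊗ₜ y)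

end ExpIntertwine

/-! ## The graph of the solution of a Riccati equation -/

section Riccati

open Polynomial

variable {S : Type*} [Ring S] [Module ℚ S]

/-- Uniqueness for a linear differential equation: `n + 1` times the coefficient of degree `n + 1`
is a combination of lower coefficients of `G`, and `n + 1` is invertible in `ℚ`. -/
theorem polynomial_eq_zero_of_derivative_eq_mul {G H : S[X]} (h : derivative G = H * G)
    (h0 : G.coeff 0 = 0) : G = 0 := by
  ext n
  induction n using Nat.strong_induction_on with
  | _ n ih =>
    rcases n with _ | n
    · simpa using h0
    · have h1 := congrArg (fun p => coeff p n) h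
      simp only [coeff_derivative, coeff_mul] at h1
      rw [Finset.sum_eq_zero] at h1
      · have h2 : ((n + 1 : ℕ) : ℚ) • G.coeff (n + 1) = 0 := by
          rw [Nat.cast_smul_eq_nsmul, nsmul_eq_mul, Nat.cast_comm]
          exact_mod_cast h1
        simpa using (smul_eq_zero_iff_right (by positivity)).1 h2
      · intro x hx
        have := Finset.HasAntidiagonal.mem_antidiagonal.1 hx
        rw [ih x.2 (by omega), coeff_zero, mul_zero]

/-- A divided power series with finitely many nonzero coefficients, as a polynomial. -/
def dividedPoly (c : ℕ → S) (N : ℕ) : S[X] :=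
  ∑ n ∈ Finset.range N, monomial n ((n.factorial : ℚ)⁻¹ • c n)

theorem coeff_dividedPoly {c : ℕ → S} {N : ℕ} (hN : ∀ n, N ≤ n → c n = 0) (n : ℕ) :
    (dividedPoly c N).coeff n = (n.factorial : ℚ)⁻¹ • c n := by
  simp only [dividedPoly, finsetSum_coeff, coeff_monomial, Finset.sum_ite_eq',
    Finset.mem_range]
  split_ifs with h
  · rfl
  · rw [hN n (by omega), smul_zero]

theorem eval_one_dividedPoly (c : ℕ → S) (N : ℕ) :
    (dividedPoly c N).eval 1 = ∑ n ∈ Finset.range N, (n.factorial : ℚ)⁻¹ • c n := by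
  simp [dividedPoly, eval_finsetSum]

theorem coeff_derivative_dividedPoly {c : ℕ → S} {N : ℕ} (hN : ∀ n, N ≤ n → c n = 0) (n : ℕ) :
    (derivative (dividedPoly c N)).coeff n = (n.factorial : ℚ)⁻¹ • c (n + 1) := by
  rw [coeff_derivative, coeff_dividedPoly hN]
  have : (n : S) + 1 = ((n + 1 : ℕ) : S) := by push_cast; rfl
  rw [this, ← Nat.cast_comm, ← nsmul_eq_mul, ← Nat.cast_smul_eq_nsmul ℚ, smul_smul,
    Nat.factorial_succ]
  congr 1
  push_cast
  field_simp

/-- With `x(t) = ∑ c n tⁿ / n!`, the hypotheses `h1` and `hrec` say that `x' = (q - x) D (p + x)`.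
Put `G = (q - x) exp (t D) (p + c 0)`, the defect of the transported graph from being the graph of
`x`. Using `1 - p = q`, one gets `G' = (q - x) D G`, and `G(0) = (q - c 0) (p + c 0) = 0`; so `G =
0`, and `t = 1` gives the claim. All series are finite, so `t` can be the central variable of
`S[X]`. -/
theorem exp_mul_graph {p q D : S} {c : ℕ → S} {N : ℕ} (hpq : p + q = 1) (hqp : q * p = 0)
    (hqc : ∀ n, q * c n = c n) (hcp : ∀ n, c n * p = c n) (hD : IsNilpotent D)
    (hN : ∀ n, N ≤ n → c n = 0)
    (h1 : c 1 = (q - c 0) * D * (p + c 0))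
    (hrec : ∀ n, c (n + 2) = q * D * c (n + 1) - c (n + 1) * D * p -
      ∑ ab ∈ Finset.HasAntidiagonal.antidiagonal (n + 1),
        ((n + 1).choose ab.1 : ℚ) • (c ab.1 * D * c ab.2)) :
    IsNilpotent.exp D * (p + c 0) =
      (p + ∑ n ∈ Finset.range N, (n.factorial : ℚ)⁻¹ • c n) *
        (p * IsNilpotent.exp D * (p + c 0)) := by
  obtain ⟨k, hk⟩ := hD
  set x := dividedPoly c N with hx
  set y := dividedPoly (fun n => D ^ n) k with hy
  have hk' : ∀ n, k ≤ n → D ^ n = 0 := fun n hn => pow_eq_zero_of_le hn hk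
  have hcq : ∀ n, c n * q = 0 := fun n => by
    rw [eq_sub_of_add_eq' hpq, mul_sub, hcp, mul_one, sub_self]
  have hcc : ∀ m n, c m * c n = 0 := fun m n => by rw [← hqc n, ← mul_assoc, hcq, zero_mul]
  have hy' : derivative y = C D * y := by
    ext n
    rw [coeff_derivative_dividedPoly hk', coeff_C_mul, coeff_dividedPoly hk', pow_succ',
      mul_smul_comm]
  have hxx : ∀ n, (x * C D * x).coeff n = (n.factorial : ℚ)⁻¹ •
      ∑ ab ∈ Finset.HasAntidiagonal.antidiagonal n,
        (n.choose ab.1 : ℚ) • (c ab.1 * D * c ab.2) := by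
    intro n
    rw [coeff_mul, Finset.smul_sum]
    refine Finset.sum_congr rfl fun ab hab => ?_
    rw [coeff_mul_C, coeff_dividedPoly hN, coeff_dividedPoly hN, smul_mul_assoc, smul_mul_assoc,
      mul_smul_comm, smul_smul, smul_smul]
    congr 1
    have := Finset.HasAntidiagonal.mem_antidiagonal.1 hab
    rw [← this, Nat.choose_symm_add, Nat.add_choose,
      Nat.cast_div (Nat.factorial_mul_factorial_dvd_factorial_add _ _) (by positivity)]
    push_cast
    field_simp
  have hx' : derivative x = (C q - x) * C D * (C p + x) := by
    ext n
    rw [coeff_derivative_dividedPoly hN]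
    have : (C q - x) * C D * (C p + x) =
        C (q * D * p) + C (q * D) * x - x * C (D * p) - x * C D * x := by
      simp only [C_mul]; noncomm_ring
    rw [this, coeff_sub, coeff_sub, coeff_add, hxx, coeff_C_mul, coeff_mul_C,
      coeff_dividedPoly hN]
    rcases n with _ | n
    · simp only [zero_add, h1, Nat.factorial_zero, Nat.cast_one, inv_one, one_smul, coeff_C_zero,
        Finset.HasAntidiagonal.antidiagonal_zero, Finset.sum_singleton, Nat.choose_self]
      noncomm_ring
    · rw [hrec, coeff_C_of_ne_zero (by omega), zero_add, smul_sub, smul_sub, mul_smul_comm,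
        smul_mul_assoc, mul_assoc (c (n + 1))]
  set G := (C q - x) * y * C (p + c 0) with hG
  have hG0 : G = 0 := by
    refine polynomial_eq_zero_of_derivative_eq_mul (H := (C q - x) * C D) ?_ ?_
    · rw [hG, derivative_mul, derivative_mul, derivative_sub, derivative_C, derivative_C, hx', hy']
      have hp1 : C p = 1 - C q := by rw [← C_1, ← C_sub, ← hpq, add_sub_cancel_right]
      rw [hp1]
      noncomm_ring
    · simp only [hG, mul_coeff_zero, coeff_sub, coeff_C_zero, hx, hy,
        coeff_dividedPoly hN, coeff_dividedPoly hk', pow_zero, Nat.factorial_zero, Nat.cast_one,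
        inv_one, one_smul, mul_one, sub_mul, mul_add, hqp, hqc, hcp, hcc, zero_add, add_zero,
        sub_self]
  -- Over a noncommutative ring, evaluation is multiplicative only at a point that commutes with the
  -- coefficients, such as `1`.
  let e : S[X] →+* S := eval₂RingHom' (RingHom.id S) 1 fun a => Commute.one_right a
  have he : ∀ f, e f = f.eval 1 := fun f => rfl
  have hG1 : (q - x.eval 1) * IsNilpotent.exp D * (p + c 0) = 0 := by
    have := congrArg e hG0
    rw [hG, map_mul, map_mul, map_sub, map_zero] at this
    simpa only [he, eval_C, hy, eval_one_dividedPoly, ← IsNilpotent.exp_eq_sum hk] using this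
  rw [← eval_one_dividedPoly, ← hx]
  have hxp : x.eval 1 * p = x.eval 1 := by
    rw [hx, eval_one_dividedPoly, Finset.sum_mul]
    simp only [smul_mul_assoc, hcp]
  have hpp : p * p = p := by
    have := congrArg (· * p) hpq
    simpa only [add_mul, hqp, add_zero, one_mul] using this
  rw [sub_mul, sub_mul, sub_eq_zero] at hG1
  calc IsNilpotent.exp D * (p + c 0) = (p + q) * IsNilpotent.exp D * (p + c 0) := by
        rw [hpq, one_mul]
    _ = p * IsNilpotent.exp D * (p + c 0) + x.eval 1 * IsNilpotent.exp D * (p + c 0) := by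
        rw [add_mul, add_mul, hG1]
    _ = p * p * IsNilpotent.exp D * (p + c 0) +
        x.eval 1 * p * IsNilpotent.exp D * (p + c 0) := by rw [hpp, hxp]
    _ = _ := by simp only [add_mul, mul_assoc]

end Riccati

/-! ## Extension of scalars: coordinates and the filtration by powers of the maximal ideal -/

section ExtensionLemmas

variable {𝕂 : Type*} [Field 𝕂] {𝒜 : Type*} [CommRing 𝒜] [Algebra 𝕂 𝒜]
  {X Y Z W : Type*} [AddCommGroup X] [Module 𝕂 X] [AddCommGroup Y] [Module 𝕂 Y]
  [AddCommGroup Z] [Module 𝕂 Z] [AddCommGroup W] [Module 𝕂 W]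

@[simp]
theorem extApp_tmul (a b : 𝒜) (φ : X →ₗ[𝕂] Y) (x : X) :
    extApp 𝒜 X Y (a ⊗ₜ φ) (b ⊗ₜ x) = (a * b) ⊗ₜ φ x := by
  simp [extApp, TensorProduct.smul_tmul']

/-- An `𝒜`-linear map on `𝒜 ⊗ X` is determined by its values on `1 ⊗ x`. -/
theorem hom_ext_one_tmul {N : Type*} [AddCommGroup N] [Module 𝒜 N] {Φ Ψ : 𝒜 ⊗[𝕂] X →ₗ[𝒜] N}
    (h : ∀ x, Φ (1 ⊗ₜ x) = Ψ (1 ⊗ₜ x)) : Φ = Ψ := by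
  refine LinearMap.ext fun t => ?_
  induction t with
  | zero => simp
  | add s t hs ht => rw [map_add, map_add, hs, ht]
  | tmul a x =>
    rw [← mul_one a, ← smul_eq_mul, ← TensorProduct.smul_tmul', map_smul, map_smul, h]

variable (X) in
/-- The map `φ ⊗ id : 𝒜 ⊗ X → X` for a linear functional `φ` on `𝒜`. -/
def coordMap (φ : 𝒜 →ₗ[𝕂] 𝕂) : 𝒜 ⊗[𝕂] X →ₗ[𝕂] X :=
  (TensorProduct.lid 𝕂 X).toLinearMap ∘ₗ φ.rTensor X

@[simp]
theorem coordMap_tmul (φ : 𝒜 →ₗ[𝕂] 𝕂) (a : 𝒜) (x : X) : coordMap X φ (a ⊗ₜ x) = φ a • x := by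
  simp [coordMap]

theorem coordMap_ext₂_left (φ : 𝒜 →ₗ[𝕂] 𝕂) (β : X →ₗ[𝕂] Y →ₗ[𝕂] Z) (t : 𝒜 ⊗[𝕂] X) (y : Y) :
    coordMap Z φ (ext₂ 𝒜 β t (1 ⊗ₜ y)) = β (coordMap X φ t) y := by
  induction t with
  | zero => simp
  | add s t hs ht => simp only [map_add, LinearMap.add_apply, hs, ht]
  | tmul a x => simp [ext₂_tmul]

theorem coordMap_ext₂_right (φ : 𝒜 →ₗ[𝕂] 𝕂) (β : X →ₗ[𝕂] Y →ₗ[𝕂] Z) (x : X) (t : 𝒜 ⊗[𝕂] Y) :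
    coordMap Z φ (ext₂ 𝒜 β (1 ⊗ₜ x) t) = β x (coordMap Y φ t) := by
  induction t with
  | zero => simp
  | add s t hs ht => simp only [map_add, hs, ht]
  | tmul a x => simp [ext₂_tmul]

theorem coordMap_baseChange (φ : 𝒜 →ₗ[𝕂] 𝕂) (f : X →ₗ[𝕂] Y) (t : 𝒜 ⊗[𝕂] X) :
    coordMap Y φ (f.baseChange 𝒜 t) = f (coordMap X φ t) := by
  induction t with
  | zero => simp
  | add s t hs ht => simp only [map_add, hs, ht]
  | tmul a x => simp

@[simp]
theorem evMap_tmul (ev : 𝒜 →ₐ[𝕂] 𝕂) (a : 𝒜) (x : X) : evMap X ev (a ⊗ₜ x) = ev a • x :=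
  coordMap_tmul _ a x

theorem evMap_baseChange (ev : 𝒜 →ₐ[𝕂] 𝕂) (f : X →ₗ[𝕂] Y) (t : 𝒜 ⊗[𝕂] X) :
    evMap Y ev (f.baseChange 𝒜 t) = f (evMap X ev t) :=
  coordMap_baseChange _ f t

theorem evMap_ext₂ (ev : 𝒜 →ₐ[𝕂] 𝕂) (β : X →ₗ[𝕂] Y →ₗ[𝕂] Z) (s : 𝒜 ⊗[𝕂] X) (t : 𝒜 ⊗[𝕂] Y) :
    evMap Z ev (ext₂ 𝒜 β s t) = β (evMap X ev s) (evMap Y ev t) := by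
  induction s with
  | zero => simp
  | add s s' hs hs' => simp only [map_add, LinearMap.add_apply, hs, hs']
  | tmul a x =>
    induction t with
    | zero => simp
    | add t t' ht ht' => simp only [map_add, ht, ht']
    | tmul b y => simp [ext₂_tmul, mul_smul, smul_comm (ev b)]

theorem sum_tmul_coordMap {ι : Type*} [Fintype ι] (b : Module.Basis ι 𝕂 𝒜) (t : 𝒜 ⊗[𝕂] X) :
    ∑ i, b i ⊗ₜ[𝕂] coordMap X (b.coord i) t = t := by
  induction t with
  | zero => simp
  | add s t hs ht => simp only [map_add, TensorProduct.tmul_add, Finset.sum_add_distrib, hs, ht]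
  | tmul a x =>
    simp only [coordMap_tmul, TensorProduct.tmul_smul, TensorProduct.smul_tmul',
      ← TensorProduct.sum_tmul]
    congr 1
    exact b.sum_repr a

theorem eq_of_coordMap_eq [Module.Finite 𝕂 𝒜] {s t : 𝒜 ⊗[𝕂] X}
    (h : ∀ φ : 𝒜 →ₗ[𝕂] 𝕂, coordMap X φ s = coordMap X φ t) : s = t := by
  let b := Module.finBasis 𝕂 𝒜
  rw [← sum_tmul_coordMap b s, ← sum_tmul_coordMap b t]
  simp only [h]

theorem mem_maximalIdeal_iff_ev [IsLocalRing 𝒜] (ev : 𝒜 →ₐ[𝕂] 𝕂) {a : 𝒜} :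
    a ∈ IsLocalRing.maximalIdeal 𝒜 ↔ ev a = 0 := by
  have hsurj : Function.Surjective ev := fun c => ⟨algebraMap 𝕂 𝒜 c, by simp⟩
  have := RingHom.ker_isMaximal_of_surjective (ev : 𝒜 →+* 𝕂) hsurj
  rw [← IsLocalRing.eq_maximalIdeal this]
  rfl

theorem sub_algebraMap_ev_mem [IsLocalRing 𝒜] (ev : 𝒜 →ₐ[𝕂] 𝕂) (a : 𝒜) :
    a - algebraMap 𝕂 𝒜 (ev a) ∈ IsLocalRing.maximalIdeal 𝒜 := by
  rw [mem_maximalIdeal_iff_ev ev]; simp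

/-- For the converse, `t - 1 ⊗ ev t` always lies in `𝔪 ⊗ X`, because `a - ev a ∈ 𝔪` for every scalar
`a`. -/
theorem mem_mPart_iff [IsLocalRing 𝒜] (ev : 𝒜 →ₐ[𝕂] 𝕂) {t : 𝒜 ⊗[𝕂] X} :
    t ∈ mPart 𝕂 𝒜 X ↔ evMap X ev t = 0 := by
  constructor
  · intro h
    refine Submodule.smul_induction_on h (fun a ha t ht => ?_) fun s t hs ht => ?_
    · clear ht
      induction t with
      | zero => simp
      | add s t hs ht => rw [smul_add, map_add, hs, ht, add_zero]
      | tmul b x =>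
        rw [TensorProduct.smul_tmul', evMap_tmul, smul_eq_mul, map_mul,
          (mem_maximalIdeal_iff_ev ev).1 ha, zero_mul, zero_smul]
    · rw [map_add, hs, ht, add_zero]
  · intro h
    have key : ∀ t : 𝒜 ⊗[𝕂] X, t - 1 ⊗ₜ evMap X ev t ∈ mPart 𝕂 𝒜 X := by
      intro t
      induction t with
      | zero => simp
      | add s t hs ht =>
        have := add_mem hs ht
        rwa [sub_add_sub_comm, ← TensorProduct.tmul_add, ← map_add] at this
      | tmul a x =>
        have : a ⊗ₜ[𝕂] x - 1 ⊗ₜ evMap X ev (a ⊗ₜ x) =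
            (a - algebraMap 𝕂 𝒜 (ev a)) • ((1 : 𝒜) ⊗ₜ[𝕂] x) := by
          rw [evMap_tmul, TensorProduct.tmul_smul, TensorProduct.smul_tmul',
            TensorProduct.smul_tmul', smul_eq_mul, mul_one, TensorProduct.sub_tmul,
            Algebra.algebraMap_eq_smul_one]
        rw [this]
        exact Submodule.smul_mem_smul (sub_algebraMap_ev_mem ev a) trivial
    simpa [h] using key t

theorem maximalIdeal_pow_eq_zero (𝒜 : Type*) [CommRing 𝒜] [IsLocalRing 𝒜] [IsArtinianRing 𝒜] :
    ∃ n, IsLocalRing.maximalIdeal 𝒜 ^ n = ⊥ := by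
  obtain ⟨n, hn⟩ := IsArtinianRing.isNilpotent_jacobson_bot (R := 𝒜)
  rw [IsLocalRing.jacobson_eq_maximalIdeal ⊥ bot_ne_top] at hn
  exact ⟨n, hn⟩

/-- Each `𝔪 ^ n` is finitely generated, and modulo `𝔪 ^ (n + 1)` its generators span it over `𝕂`,
because `a` acts there as `ev a`. Nilpotency of `𝔪` ends the process. -/
theorem finite_of_isArtinianRing [IsLocalRing 𝒜] [IsArtinianRing 𝒜] (ev : 𝒜 →ₐ[𝕂] 𝕂) :
    Module.Finite 𝕂 𝒜 := by
  have key : ∀ n, ∃ V : Submodule 𝕂 𝒜, V.FG ∧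
      V ⊔ (IsLocalRing.maximalIdeal 𝒜 ^ n).restrictScalars 𝕂 = ⊤ := by
    intro n
    induction n with
    | zero => exact ⟨⊥, Submodule.fg_bot, by simp [Ideal.one_eq_top]⟩
    | succ n ih =>
      obtain ⟨V, hV, hVn⟩ := ih
      obtain ⟨s, hs⟩ : (IsLocalRing.maximalIdeal 𝒜 ^ n).FG := IsNoetherian.noetherian _
      refine ⟨V ⊔ Submodule.span 𝕂 (s : Set 𝒜), hV.sup (Submodule.fg_span s.finite_toSet), ?_⟩
      rw [eq_top_iff, ← hVn, sup_assoc]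
      refine sup_le_sup_left ?_ V
      intro x hx
      rw [Submodule.restrictScalars_mem, ← hs] at hx
      refine Submodule.span_induction (fun y hy => ?_) (zero_mem _)
        (fun y z _ _ hy hz => add_mem hy hz) (fun a y hy hyW => ?_) hx
      · exact Submodule.mem_sup_left (Submodule.subset_span hy)
      have h1 : (a - algebraMap 𝕂 𝒜 (ev a)) * y ∈ IsLocalRing.maximalIdeal 𝒜 ^ (n + 1) := by
        rw [pow_succ']
        exact Ideal.mul_mem_mul (sub_algebraMap_ev_mem ev a) (hs ▸ hy)
      have h2 : a • y = (a - algebraMap 𝕂 𝒜 (ev a)) * y + ev a • y := by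
        rw [Algebra.smul_def (ev a), sub_mul, sub_add_cancel, smul_eq_mul]
      rw [h2]
      exact add_mem (Submodule.mem_sup_right h1) (Submodule.smul_mem _ _ hyW)
  obtain ⟨n, hn⟩ := maximalIdeal_pow_eq_zero 𝒜
  obtain ⟨V, hV, hVn⟩ := key n
  rw [hn] at hVn
  refine ⟨?_⟩
  have : V = ⊤ := by simpa using hVn
  rwa [← this]

/-! ### Powers of the maximal ideal -/

theorem bilinear_mem_mul_smul {M N Q : Type*} [AddCommGroup M] [Module 𝒜 M] [AddCommGroup N]
    [Module 𝒜 N] [AddCommGroup Q] [Module 𝒜 Q] (β : M →ₗ[𝒜] N →ₗ[𝒜] Q) {I J : Ideal 𝒜} {x : M}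
    {y : N} (hx : x ∈ I • (⊤ : Submodule 𝒜 M)) (hy : y ∈ J • (⊤ : Submodule 𝒜 N)) :
    β x y ∈ (I * J) • (⊤ : Submodule 𝒜 Q) := by
  refine Submodule.smul_induction_on hx (fun a ha x _ => ?_) fun x x' h h' => ?_
  · refine Submodule.smul_induction_on hy (fun b hb y _ => ?_) fun y y' h h' => ?_
    · rw [map_smul, map_smul, LinearMap.smul_apply, smul_smul, mul_comm I J]
      exact Submodule.smul_mem_smul (Ideal.mul_mem_mul hb ha) trivial
    · rw [map_add]; exact add_mem h h'
  · rw [map_add, LinearMap.add_apply]; exact add_mem h h'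

theorem linear_mem_smul {M N : Type*} [AddCommGroup M] [Module 𝒜 M] [AddCommGroup N]
    [Module 𝒜 N] (f : M →ₗ[𝒜] N) {I : Ideal 𝒜} {x : M} (hx : x ∈ I • (⊤ : Submodule 𝒜 M)) :
    f x ∈ I • (⊤ : Submodule 𝒜 N) := by
  refine Submodule.smul_induction_on hx (fun a ha x _ => ?_) fun x x' h h' => ?_
  · rw [map_smul]; exact Submodule.smul_mem_smul ha trivial
  · rw [map_add]; exact add_mem h h'

/-- A map with zero center takes values in `𝔪 ⊗ X`, so by `𝒜`-linearity its `n`-th power takes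
values in `𝔪 ^ n ⊗ X`. -/
theorem isNilpotent_of_evMap_apply_eq_zero [IsLocalRing 𝒜] [IsArtinianRing 𝒜] (ev : 𝒜 →ₐ[𝕂] 𝕂)
    {Φ : Module.End 𝒜 (𝒜 ⊗[𝕂] X)} (h : ∀ x, evMap X ev (Φ (1 ⊗ₜ x)) = 0) : IsNilpotent Φ := by
  have h1 : ∀ t, Φ t ∈ IsLocalRing.maximalIdeal 𝒜 • (⊤ : Submodule 𝒜 (𝒜 ⊗[𝕂] X)) := by
    intro t
    induction t with
    | zero => simp
    | add s t hs ht => rw [map_add]; exact add_mem hs ht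
    | tmul a x =>
      rw [← mul_one a, ← smul_eq_mul, ← TensorProduct.smul_tmul', map_smul]
      exact Submodule.smul_mem _ _ ((mem_mPart_iff ev).2 (h x))
  have h2 : ∀ n t, (Φ ^ n) t ∈
      IsLocalRing.maximalIdeal 𝒜 ^ n • (⊤ : Submodule 𝒜 (𝒜 ⊗[𝕂] X)) := by
    intro n
    induction n with
    | zero => intro t; simp
    | succ n ih =>
      intro t
      rw [pow_succ Φ, Module.End.mul_apply, pow_succ', Submodule.mul_smul]
      refine Submodule.smul_induction_on (h1 t) (fun a ha x _ => ?_) fun x x' h h' => ?_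
      · rw [map_smul]; exact Submodule.smul_mem_smul ha (ih x)
      · rw [map_add]; exact add_mem h h'
  obtain ⟨n, hn⟩ := maximalIdeal_pow_eq_zero 𝒜
  refine ⟨n, LinearMap.ext fun t => ?_⟩
  simpa [hn] using h2 n t

end ExtensionLemmas

/-! ### Orders of the exponential terms and symmetrized sums -/

section CubicLemmas

variable {𝕂 : Type*} [Field 𝕂] {𝒜 : Type*} [CommRing 𝒜] [Algebra 𝕂 𝒜]
  {X Y Z W : Type*} [AddCommGroup X] [Module 𝕂 X] [AddCommGroup Y] [Module 𝕂 Y]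
  [AddCommGroup Z] [Module 𝕂 Z] [AddCommGroup W] [Module 𝕂 W]

theorem ext₂_mem_mul_smul (β : X →ₗ[𝕂] Y →ₗ[𝕂] Z) {I J : Ideal 𝒜} {x : 𝒜 ⊗[𝕂] X} {y : 𝒜 ⊗[𝕂] Y}
    (hx : x ∈ I • (⊤ : Submodule 𝒜 (𝒜 ⊗[𝕂] X))) (hy : y ∈ J • (⊤ : Submodule 𝒜 (𝒜 ⊗[𝕂] Y))) :
    ext₂ 𝒜 β x y ∈ (I * J) • (⊤ : Submodule 𝒜 (𝒜 ⊗[𝕂] Z)) :=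
  bilinear_mem_mul_smul (ext₂ 𝒜 β) hx hy

theorem ext₃_mem_mul_smul (τ : X →ₗ[𝕂] Y →ₗ[𝕂] Z →ₗ[𝕂] W) {I J K : Ideal 𝒜} {x : 𝒜 ⊗[𝕂] X}
    {y : 𝒜 ⊗[𝕂] Y} {z : 𝒜 ⊗[𝕂] Z} (hx : x ∈ I • (⊤ : Submodule 𝒜 (𝒜 ⊗[𝕂] X)))
    (hy : y ∈ J • (⊤ : Submodule 𝒜 (𝒜 ⊗[𝕂] Y))) (hz : z ∈ K • (⊤ : Submodule 𝒜 (𝒜 ⊗[𝕂] Z))) :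
    ext₃ 𝒜 τ x y z ∈ (I * J * K) • (⊤ : Submodule 𝒜 (𝒜 ⊗[𝕂] W)) :=
  bilinear_mem_mul_smul (extApp 𝒜 Z W) (ext₂_mem_mul_smul τ hx hy) hz

variable {g₀ g₁ g₂ : Type*} [AddCommGroup g₀] [Module 𝕂 g₀] [AddCommGroup g₁] [Module 𝕂 g₁]
  [AddCommGroup g₂] [Module 𝕂 g₂]

/-- Every step of the recursion contributes one more factor `b`, while `ξ` is only counted as having
order zero. With `I = 𝔪` this makes the exponential a finite sum. -/
theorem CubicBrackets.expTerm_mem (C : CubicBrackets 𝕂 g₀ g₁ g₂) {I : Ideal 𝒜} (ξ : 𝒜 ⊗[𝕂] g₁)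
    {b : 𝒜 ⊗[𝕂] g₀} (hb : b ∈ I • (⊤ : Submodule 𝒜 (𝒜 ⊗[𝕂] g₀))) (n : ℕ) :
    C.expTerm ξ b (n + 1) ∈ I ^ (n + 1) • (⊤ : Submodule 𝒜 (𝒜 ⊗[𝕂] g₁)) := by
  have htop : ξ ∈ (1 : Ideal 𝒜) • (⊤ : Submodule 𝒜 (𝒜 ⊗[𝕂] g₁)) := by simp
  have hsmul : ∀ (c : 𝕂) {J : Ideal 𝒜} {x : 𝒜 ⊗[𝕂] g₁},
      x ∈ J • (⊤ : Submodule 𝒜 (𝒜 ⊗[𝕂] g₁)) → c • x ∈ J • (⊤ : Submodule 𝒜 (𝒜 ⊗[𝕂] g₁)) :=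
    fun c J x hx => Submodule.smul_of_tower_mem _ c hx
  induction n using Nat.strong_induction_on with
  | _ n ih =>
    rcases n with _ | n
    · rw [CubicBrackets.expTerm, CubicBrackets.twisted₁, zero_add, pow_one]
      refine add_mem (sub_mem (linear_mem_smul _ hb) ?_) (hsmul _ ?_)
      · simpa only [mul_one] using ext₂_mem_mul_smul C.br₀₁ hb htop
      · simpa only [mul_one] using ext₃_mem_mul_smul C.br₀₁₁ hb htop htop
    · rw [CubicBrackets.expTerm, CubicBrackets.twisted₂]
      refine add_mem (sub_mem ?_ ?_) (hsmul _ (sum_mem fun p _ => hsmul _ ?_))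
      · rw [pow_succ']
        exact ext₂_mem_mul_smul C.br₀₁ hb (ih n (by omega))
      · have := ext₃_mem_mul_smul C.br₀₁₁ hb htop (ih n (by omega))
        rwa [mul_one, ← pow_succ'] at this
      · have hp := p.2
        -- The two entries have orders `p + 1` and `n - p`; together with `b` this gives `n + 2`.
        have := ext₃_mem_mul_smul C.br₀₁₁ hb (ih p (by omega)) (ih (n - p - 1) (by omega))
        rw [← pow_succ', ← pow_add, show n - p - 1 + 1 = n - p by omega,
          show (p : ℕ) + 1 + 1 + (n - p) = n + 1 + 1 by omega] at this
        exact this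

/-- A sum over an antidiagonal, symmetrized, with its two extremal terms split off. -/
theorem sum_antidiagonal_succ_symm [CharZero 𝕂] (f : ℕ → ℕ → X) (n : ℕ) :
    ∑ ab ∈ Finset.HasAntidiagonal.antidiagonal (n + 1),
        ((n + 1).choose ab.1 : 𝕂) • f ab.1 ab.2 =
      f 0 (n + 1) + f (n + 1) 0 + (2 : 𝕂)⁻¹ • ∑ p : Fin n, ((n + 1).choose (p + 1) : 𝕂) •
        (f (n - p) (p + 1) + f (p + 1) (n - p)) := by
  rw [Finset.Nat.sum_antidiagonal_eq_sum_range_succ_mk, Finset.sum_range_succ,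
    Finset.sum_range_succ']
  simp only [Nat.choose_self, Nat.choose_zero_right, Nat.cast_one, one_smul, Nat.sub_self,
    Nat.sub_zero, smul_add, Finset.sum_add_distrib, Nat.add_sub_add_right]
  rw [Fin.sum_univ_eq_sum_range (fun p => ((n + 1).choose (p + 1) : 𝕂) • f (n - p) (p + 1)),
    Fin.sum_univ_eq_sum_range (fun p => ((n + 1).choose (p + 1) : 𝕂) • f (p + 1) (n - p))]
  -- The reflection `p ↦ n - 1 - p` exchanges the two arguments and preserves the binomial
  -- coefficient.
  have h : ∑ p ∈ Finset.range n, ((n + 1).choose (p + 1) : 𝕂) • f (n - p) (p + 1) =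
      ∑ p ∈ Finset.range n, ((n + 1).choose (p + 1) : 𝕂) • f (p + 1) (n - p) := by
    rw [← Finset.sum_range_reflect]
    refine Finset.sum_congr rfl fun p hp => ?_
    have hp' := Finset.mem_range.1 hp
    rw [show n - (n - 1 - p) = p + 1 by omega, show n - 1 - p + 1 = n - p by omega,
      show n - p = n + 1 - (p + 1) by omega, Nat.choose_symm (by omega)]
  rw [h, ← smul_add, ← two_smul 𝕂 (∑ p ∈ Finset.range n, ((n + 1).choose (p + 1) : 𝕂) • f (p + 1) (n - p)),
    smul_smul, inv_mul_cancel₀ two_ne_zero, one_smul]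
  abel

end CubicLemmas

/-! ## The Cartesian extension of a Lie algebroid and its derivations -/

section CartesianLemmas

variable {𝕂 : Type*} [Field 𝕂] {R : Type*} [CommRing R] [Algebra 𝕂 R]
  {Γ : Type*} [AddCommGroup Γ] [Module 𝕂 Γ] [Module R Γ] [IsScalarTower 𝕂 R Γ]
  {Γ' : Type*} [AddCommGroup Γ'] [Module 𝕂 Γ'] [Module R Γ'] [IsScalarTower 𝕂 R Γ']
  {𝒜 : Type*} [CommRing 𝒜] [Algebra 𝕂 𝒜]

@[simp]
theorem fmul_tmul (a b : 𝒜) (f : R) (u : Γ) :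
    fmul 𝒜 (a ⊗ₜ[𝕂] f) (b ⊗ₜ[𝕂] u) = (a * b) ⊗ₜ (f • u) := by
  rw [fmul, ext₂_tmul]; rfl

@[simp]
theorem vact_tmul (a b : 𝒜) (D : Derivation 𝕂 R R) (f : R) :
    vact 𝕂 R 𝒜 (a ⊗ₜ D) (b ⊗ₜ f) = (a * b) ⊗ₜ D f := by
  rw [vact, ext₂_tmul]; rfl

theorem baseChange_fmul (φ : Γ →ₗ[R] Γ') (f : 𝒜 ⊗[𝕂] R) (u : 𝒜 ⊗[𝕂] Γ) :
    (φ.restrictScalars 𝕂).baseChange 𝒜 (fmul 𝒜 f u) =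
      fmul 𝒜 f ((φ.restrictScalars 𝕂).baseChange 𝒜 u) := by
  induction f with
  | zero => simp
  | add f g hf hg => simp only [map_add, LinearMap.add_apply, hf, hg]
  | tmul a f =>
    induction u with
    | zero => simp
    | add u v hu hv => simp only [map_add, hu, hv]
    | tmul b u => simp

variable (E : LieAlgebroidStr 𝕂 R Γ)

namespace LieAlgebroidStr

theorem cartesian_bracket : (E.cartesian 𝒜).bracket = ext₂ 𝒜 E.bracket := rfl

theorem cartesian_anchor :
    (E.cartesian 𝒜).anchor = (E.anchor.restrictScalars 𝕂).baseChange 𝒜 := rfl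

theorem cartesian_skew (u v : 𝒜 ⊗[𝕂] Γ) :
    (E.cartesian 𝒜).bracket u v = -(E.cartesian 𝒜).bracket v u := by
  rw [E.cartesian_bracket]
  induction u with
  | zero => simp
  | add u u' h h' => simp only [map_add, LinearMap.add_apply, h, h', neg_add]
  | tmul a u =>
    induction v with
    | zero => simp
    | add v v' h h' => simp only [map_add, LinearMap.add_apply, h, h', neg_add]
    | tmul b v => rw [ext₂_tmul, ext₂_tmul, E.skew u v, TensorProduct.tmul_neg, mul_comm]

theorem cartesian_isLieAlgebroid : (E.cartesian 𝒜).IsLieAlgebroid where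
  anchor_fmul f u := baseChange_fmul E.anchor f u
  bracket_self u := by
    induction u with
    | zero => simp
    | add u v hu hv =>
      simp only [map_add, LinearMap.add_apply, hu, hv, E.cartesian_skew u v]
      abel
    | tmul a u => rw [E.cartesian_bracket, ext₂_tmul, E.bracket_self, TensorProduct.tmul_zero]
  jacobi u v w := by
    rw [E.cartesian_bracket]
    induction u with
    | zero => simp
    | add u u' h h' => simp only [map_add, LinearMap.add_apply, h, h']; abel
    | tmul a u =>
      induction v with
      | zero => simp
      | add v v' h h' => simp only [map_add, LinearMap.add_apply, h, h']; abel
      | tmul b v =>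
        induction w with
        | zero => simp
        | add w w' h h' => simp only [map_add, h, h']; abel
        | tmul c w =>
          simp only [ext₂_tmul]
          rw [E.jacobi, TensorProduct.tmul_add, mul_assoc, mul_left_comm b a c]
  leibniz u f v := by
    rw [E.cartesian_bracket, E.cartesian_anchor]
    induction u with
    | zero => simp
    | add u u' h h' => simp only [map_add, LinearMap.add_apply, h, h']; abel
    | tmul a u =>
      induction f with
      | zero => simp
      | add f f' h h' => simp only [map_add, LinearMap.add_apply, h, h']; abel
      | tmul b f =>
        induction v with
        | zero => simp
        | add v v' h h' => simp only [map_add, h, h']; abel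
        | tmul c v =>
          simp only [ext₂_tmul, fmul_tmul, LinearMap.baseChange_tmul, vact_tmul,
            LinearMap.restrictScalars_apply]
          rw [E.leibniz, TensorProduct.tmul_add, mul_assoc, mul_left_comm b a c]

/-- The operator on sections underlying a derivation. -/
def derOp : E.Der →ₗ[𝕂] Module.End 𝕂 Γ := LinearMap.fst 𝕂 _ _ ∘ₗ E.Der.subtype

/-- The symbol of a derivation. -/
def derSymb : E.Der →ₗ[𝕂] Module.End 𝕂 R :=
  { toFun := fun D => D.1.2.toLinearMap
    map_add' := fun _ _ => rfl
    map_smul' := fun _ _ => rfl }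

@[simp]
theorem derOp_apply (δ : E.Der) (u : Γ) : E.derOp δ u = δ.1.1 u := rfl

@[simp]
theorem derSymb_apply (δ : E.Der) (f : R) : E.derSymb δ f = δ.1.2 f := rfl

/-- The inner derivation given by a section. -/
def ad : Γ →ₗ[𝕂] E.Der where
  toFun u := ⟨(E.bracket u, E.anchor u), fun f v => E.leibniz u v f,
    fun v => (E.anchor_bracket u v).symm, fun v w => E.jacobi u v w⟩
  map_add' u v := Subtype.ext (Prod.ext (by simp) (by simp))
  map_smul' c u := Subtype.ext (Prod.ext (by simp) (by simp [LinearMap.map_smul_of_tower]))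

/-- The operator on sections and the operator on functions satisfy all the Leibniz rules of a
derivation of the `𝒜`-Cartesian extension of `E`. -/
structure IsExtDer (Δ : Module.End 𝒜 (𝒜 ⊗[𝕂] Γ)) (σ : Module.End 𝒜 (𝒜 ⊗[𝕂] R)) : Prop where
  mul : ∀ f g, σ (f * g) = σ f * g + f * σ g
  fmul : ∀ f u, Δ (fmul 𝒜 f u) = LiePairs.fmul 𝒜 (σ f) u + LiePairs.fmul 𝒜 f (Δ u)
  bracket : ∀ u v, Δ ((E.cartesian 𝒜).bracket u v) =
    (E.cartesian 𝒜).bracket (Δ u) v + (E.cartesian 𝒜).bracket u (Δ v)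
  anchor : ∀ u f, σ (vact 𝕂 R 𝒜 ((E.cartesian 𝒜).anchor u) f) =
    vact 𝕂 R 𝒜 ((E.cartesian 𝒜).anchor (Δ u)) f + vact 𝕂 R 𝒜 ((E.cartesian 𝒜).anchor u) (σ f)

theorem isExtDer_zero : E.IsExtDer (0 : Module.End 𝒜 (𝒜 ⊗[𝕂] Γ)) 0 := by
  constructor <;> simp

variable {E} in
theorem IsExtDer.add {Δ Δ' : Module.End 𝒜 (𝒜 ⊗[𝕂] Γ)} {σ σ' : Module.End 𝒜 (𝒜 ⊗[𝕂] R)}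
    (h : E.IsExtDer Δ σ) (h' : E.IsExtDer Δ' σ') : E.IsExtDer (Δ + Δ') (σ + σ') where
  mul f g := by simp only [LinearMap.add_apply, h.mul, h'.mul, add_mul, mul_add]; abel
  fmul f g := by simp only [LinearMap.add_apply, h.fmul, h'.fmul, map_add]; abel
  bracket f g := by simp only [LinearMap.add_apply, h.bracket, h'.bracket, map_add]; abel
  anchor f g := by simp only [LinearMap.add_apply, h.anchor, h'.anchor, map_add]; abel

theorem isExtDer_tmul (a : 𝒜) (δ : E.Der) :
    E.IsExtDer (ext₂ 𝒜 E.derOp (a ⊗ₜ δ)) (ext₂ 𝒜 E.derSymb (a ⊗ₜ δ)) where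
  mul f g := by
    induction f with
    | zero => simp
    | add f f' h h' => simp only [map_add, add_mul, h, h']; abel
    | tmul b f =>
      induction g with
      | zero => simp
      | add g g' h h' => simp only [map_add, mul_add, h, h']; abel
      | tmul c g =>
        simp only [ext₂_tmul, derSymb_apply, Algebra.TensorProduct.tmul_mul_tmul,
          Derivation.leibniz, smul_eq_mul, TensorProduct.tmul_add]
        rw [add_comm, mul_assoc, mul_left_comm b a c, mul_comm g]
  fmul f u := by
    induction f with
    | zero => simp
    | add f f' h h' => simp only [map_add, LinearMap.add_apply, h, h']; abel
    | tmul b f =>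
      induction u with
      | zero => simp
      | add u u' h h' => simp only [map_add, h, h']; abel
      | tmul c u =>
        simp only [ext₂_tmul, derOp_apply, derSymb_apply, fmul_tmul, δ.2.1,
          TensorProduct.tmul_add]
        rw [mul_assoc, mul_left_comm b a c]
  bracket u v := by
    rw [E.cartesian_bracket]
    induction u with
    | zero => simp
    | add u u' h h' => simp only [map_add, LinearMap.add_apply, h, h']; abel
    | tmul b u =>
      induction v with
      | zero => simp
      | add v v' h h' => simp only [map_add, h, h']; abel
      | tmul c v =>
        simp only [ext₂_tmul, derOp_apply, δ.2.2.2, TensorProduct.tmul_add]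
        rw [mul_assoc, mul_left_comm b a c]
  anchor u f := by
    rw [E.cartesian_anchor]
    induction u with
    | zero => simp
    | add u u' h h' => simp only [map_add, LinearMap.add_apply, h, h']; abel
    | tmul b u =>
      induction f with
      | zero => simp
      | add f f' h h' => simp only [map_add, h, h']; abel
      | tmul c f =>
        simp only [ext₂_tmul, derOp_apply, derSymb_apply, vact_tmul, LinearMap.baseChange_tmul,
          LinearMap.restrictScalars_apply, ← δ.2.2.1, Derivation.commutator_apply]
        rw [mul_left_comm b a c, ← mul_assoc, ← TensorProduct.tmul_add, sub_add_cancel]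

theorem isExtDer_ext₂ (D : 𝒜 ⊗[𝕂] E.Der) :
    E.IsExtDer (ext₂ 𝒜 E.derOp D) (ext₂ 𝒜 E.derSymb D) := by
  induction D with
  | zero => simpa using E.isExtDer_zero
  | add D D' h h' => rw [map_add, map_add]; exact h.add h'
  | tmul a δ => exact E.isExtDer_tmul a δ

variable {E} in
/-- Every derivation of the `𝒜`-Cartesian extension comes from `Der(E) ⊗ 𝒜`. -/
theorem IsExtDer.exists_eq [Module.Finite 𝕂 𝒜] {Δ : Module.End 𝒜 (𝒜 ⊗[𝕂] Γ)}
    {σ : Module.End 𝒜 (𝒜 ⊗[𝕂] R)} (h : E.IsExtDer Δ σ) :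
    ∃ D : 𝒜 ⊗[𝕂] E.Der, ext₂ 𝒜 E.derOp D = Δ ∧ ext₂ 𝒜 E.derSymb D = σ := by
  let b := Module.finBasis 𝕂 𝒜
  -- A linear functional on `𝒜` applied to the values on `1 ⊗ u` and `1 ⊗ f` turns the extended
  -- Leibniz rules into those of an honest derivation of `E`; these components are then reassembled
  -- along a basis.
  let Δ' (φ : 𝒜 →ₗ[𝕂] 𝕂) : Module.End 𝕂 Γ :=
    coordMap Γ φ ∘ₗ Δ.restrictScalars 𝕂 ∘ₗ TensorProduct.mk 𝕂 𝒜 Γ 1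
  let σ' (φ : 𝒜 →ₗ[𝕂] 𝕂) : Derivation 𝕂 R R := Derivation.mk'
    (coordMap R φ ∘ₗ σ.restrictScalars 𝕂 ∘ₗ TensorProduct.mk 𝕂 𝒜 R 1) fun f g => by
      have h1 := congrArg (coordMap R φ) (h.mul (1 ⊗ₜ f) (1 ⊗ₜ g))
      have e1 := coordMap_ext₂_left φ (LinearMap.mul 𝕂 R) (σ (1 ⊗ₜ f)) g
      have e2 := coordMap_ext₂_right φ (LinearMap.mul 𝕂 R) f (σ (1 ⊗ₜ g))
      have e : ∀ s t : 𝒜 ⊗[𝕂] R, ext₂ 𝒜 (LinearMap.mul 𝕂 R) s t = s * t := by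
        intro s t
        induction s with
        | zero => simp
        | add s s' hs hs' => simp only [map_add, LinearMap.add_apply, hs, hs', add_mul]
        | tmul a x =>
          induction t with
          | zero => simp
          | add t t' ht ht' => simp only [map_add, ht, ht', mul_add]
          | tmul b y => simp [ext₂_tmul]
      rw [e] at e1 e2
      rw [map_add, e1, e2] at h1
      simpa [mul_comm, add_comm] using h1
  have hmem : ∀ φ, (Δ' φ, σ' φ) ∈ E.Der := fun φ => by
    refine ⟨fun f u => ?_, fun u => ?_, fun u v => ?_⟩
    · have h1 := congrArg (coordMap Γ φ) (h.fmul (1 ⊗ₜ f) (1 ⊗ₜ u))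
      rw [map_add, LiePairs.fmul, coordMap_ext₂_left, coordMap_ext₂_right, ext₂_tmul] at h1
      simpa [Δ', σ'] using h1
    · ext f
      have h1 := congrArg (coordMap R φ) (h.anchor (1 ⊗ₜ u) (1 ⊗ₜ f))
      rw [map_add, vact, coordMap_ext₂_left, E.cartesian_anchor, coordMap_baseChange,
        LinearMap.baseChange_tmul, coordMap_ext₂_right, ext₂_tmul] at h1
      rw [Derivation.commutator_apply, sub_eq_iff_eq_add]
      simpa [Δ', σ'] using h1
    · have h1 := congrArg (coordMap Γ φ) (h.bracket (1 ⊗ₜ u) (1 ⊗ₜ v))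
      rw [map_add, E.cartesian_bracket, coordMap_ext₂_left, coordMap_ext₂_right, ext₂_tmul] at h1
      simpa [Δ'] using h1
  refine ⟨∑ i, b i ⊗ₜ ⟨_, hmem (b.coord i)⟩, ?_, ?_⟩
  · refine hom_ext_one_tmul fun u => ?_
    rw [map_sum, LinearMap.sum_apply, ← sum_tmul_coordMap b (Δ (1 ⊗ₜ u))]
    refine Finset.sum_congr rfl fun i _ => ?_
    rw [ext₂_tmul, mul_one]; rfl
  · refine hom_ext_one_tmul fun u => ?_
    rw [map_sum, LinearMap.sum_apply, ← sum_tmul_coordMap b (σ (1 ⊗ₜ u))]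
    refine Finset.sum_congr rfl fun i _ => ?_
    rw [ext₂_tmul, mul_one]; rfl

end LieAlgebroidStr

end CartesianLemmas

/-! ## Small automorphisms as exponentials of derivations -/

section SmallAut

variable {𝕂 : Type*} [Field 𝕂] {R : Type*} [CommRing R] [Algebra 𝕂 R]
  {Γ : Type*} [AddCommGroup Γ] [Module 𝕂 Γ] [Module R Γ] [IsScalarTower 𝕂 R Γ]
  {𝒜 : Type*} [CommRing 𝒜] [Algebra 𝕂 𝒜]
  {X Y : Type*} [AddCommGroup X] [Module 𝕂 X] [AddCommGroup Y] [Module 𝕂 Y]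

theorem evMap_apply_eq_zero (ev : 𝒜 →ₐ[𝕂] 𝕂) {Φ : 𝒜 ⊗[𝕂] X →ₗ[𝒜] 𝒜 ⊗[𝕂] Y}
    (h : ∀ x, evMap Y ev (Φ (1 ⊗ₜ x)) = 0) (t : 𝒜 ⊗[𝕂] X) : evMap Y ev (Φ t) = 0 := by
  have hs : ∀ (a : 𝒜) (t : 𝒜 ⊗[𝕂] Y), evMap Y ev (a • t) = ev a • evMap Y ev t := by
    intro a t
    induction t with
    | zero => simp
    | add s t hs ht => simp only [smul_add, map_add, hs, ht]
    | tmul b y => simp [TensorProduct.smul_tmul', mul_smul]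
  induction t with
  | zero => simp
  | add s t hs ht => rw [map_add, map_add, hs, ht, add_zero]
  | tmul a x =>
    rw [← mul_one a, ← smul_eq_mul, ← TensorProduct.smul_tmul', map_smul, hs, h, smul_zero]

/-- Beyond the identity, every term of `exp Φ` begins with a factor `Φ`, which has zero center. -/
theorem evMap_exp_apply [IsLocalRing 𝒜] [IsArtinianRing 𝒜] [Module ℚ (𝒜 ⊗[𝕂] X)]
    (ev : 𝒜 →ₐ[𝕂] 𝕂) {Φ : Module.End 𝒜 (𝒜 ⊗[𝕂] X)}
    (h : ∀ x, evMap X ev (Φ (1 ⊗ₜ x)) = 0) (t : 𝒜 ⊗[𝕂] X) :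
    evMap X ev (IsNilpotent.exp Φ t) = evMap X ev t := by
  obtain ⟨c, -, hc⟩ :=
    exists_exp_eq_one_add_add_sq_mul (S := Module.End 𝒜 (𝒜 ⊗[𝕂] X))
      (isNilpotent_of_evMap_apply_eq_zero ev h)
  have h0 := evMap_apply_eq_zero ev h
  simp [hc, sq, h0]

theorem exists_exp_eq_of_evMap_apply [IsLocalRing 𝒜] [IsArtinianRing 𝒜] [Module ℚ (𝒜 ⊗[𝕂] X)]
    (ev : 𝒜 →ₐ[𝕂] 𝕂) {Φ : Module.End 𝒜 (𝒜 ⊗[𝕂] X)}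
    (h : ∀ x, evMap X ev (Φ (1 ⊗ₜ x)) = x) :
    ∃ Δ : Module.End 𝒜 (𝒜 ⊗[𝕂] X), (∀ x, evMap X ev (Δ (1 ⊗ₜ x)) = 0) ∧
      IsNilpotent.exp Δ = Φ := by
  have h1 : ∀ x, evMap X ev ((Φ - 1) (1 ⊗ₜ x)) = 0 := fun x => by simp [h]
  obtain ⟨c, -, hc⟩ :=
    exists_exp_eq_one_add (S := Module.End 𝒜 (𝒜 ⊗[𝕂] X)) (isNilpotent_of_evMap_apply_eq_zero ev h1)
  exact ⟨(Φ - 1) * c, fun x => evMap_apply_eq_zero ev h1 _, by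
    rw [hc]; exact add_sub_cancel 1 Φ⟩

namespace LieAlgebroidStr

variable {E : LieAlgebroidStr 𝕂 R Γ} [IsLocalRing 𝒜] [IsArtinianRing 𝒜]
  [Module ℚ (𝒜 ⊗[𝕂] Γ)] [Module ℚ (𝒜 ⊗[𝕂] R)] (ev : 𝒜 →ₐ[𝕂] 𝕂)

theorem IsExtDer.exp_isSmallAut {Δ : Module.End 𝒜 (𝒜 ⊗[𝕂] Γ)} {σ : Module.End 𝒜 (𝒜 ⊗[𝕂] R)}
    (h : E.IsExtDer Δ σ) (hΔ : ∀ u, evMap Γ ev (Δ (1 ⊗ₜ u)) = 0)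
    (hσ : ∀ f, evMap R ev (σ (1 ⊗ₜ f)) = 0) :
    ∃ μ : 𝒜 ⊗[𝕂] R →ₐ[𝒜] 𝒜 ⊗[𝕂] R, E.IsSmallAut ev (IsNilpotent.exp Δ) μ := by
  have nΔ := isNilpotent_of_evMap_apply_eq_zero ev hΔ
  have nσ := isNilpotent_of_evMap_apply_eq_zero ev hσ
  have hmul := (exp_bilinear_iff (LinearMap.mul 𝒜 (𝒜 ⊗[𝕂] R)) nσ nσ nσ).2 h.mul
  -- A multiplicative map that attains the value `1` is unital; `exp σ` attains it at `exp (-σ) 1`.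
  have hone : IsNilpotent.exp σ 1 = 1 := by
    have h1 := hmul 1 (IsNilpotent.exp (-σ) 1)
    have h2 : IsNilpotent.exp σ (IsNilpotent.exp (-σ) 1) = 1 := by
      rw [← Module.End.mul_apply, IsNilpotent.exp_mul_exp_neg_self nσ, Module.End.one_apply]
    simpa [h2] using h1.symm
  refine ⟨AlgHom.ofLinearMap (IsNilpotent.exp σ) hone hmul, ⟨fun f => ?_, ?_, ?_, ?_⟩, fun u => ?_⟩
  · exact (evMap_exp_apply ev hσ _).trans (by simp)
  · exact (exp_bilinear_iff (LiePairs.fmul 𝒜) nσ nΔ nΔ).2 h.fmul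
  · exact (exp_bilinear_iff (E.cartesian 𝒜).bracket nΔ nΔ nΔ).2 h.bracket
  · exact (exp_bilinear_iff (vact 𝕂 R 𝒜 ∘ₗ (E.cartesian 𝒜).anchor) nΔ nσ nσ).2 h.anchor
  · exact (evMap_exp_apply ev hΔ _).trans (by simp)

/-- Both `Φ` and `μ` are unipotent and have logarithms; each compatibility in the definition of a
morphism concerns a bilinear operation, so `exp_bilinear_iff` turns it into a Leibniz rule. -/
theorem IsSmallAut.exists_exp_eq {Φ : Module.End 𝒜 (𝒜 ⊗[𝕂] Γ)} {μ : 𝒜 ⊗[𝕂] R →ₐ[𝒜] 𝒜 ⊗[𝕂] R}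
    (h : E.IsSmallAut ev Φ μ) :
    ∃ (Δ : Module.End 𝒜 (𝒜 ⊗[𝕂] Γ)) (σ : Module.End 𝒜 (𝒜 ⊗[𝕂] R)), E.IsExtDer Δ σ ∧
      (∀ u, evMap Γ ev (Δ (1 ⊗ₜ u)) = 0) ∧ (∀ f, evMap R ev (σ (1 ⊗ₜ f)) = 0) ∧
      IsNilpotent.exp Δ = Φ := by
  obtain ⟨⟨hs, hf, hb, ha⟩, hc⟩ := h
  obtain ⟨Δ, hΔ, rfl⟩ := exists_exp_eq_of_evMap_apply ev hc
  obtain ⟨σ, hσ, he⟩ := exists_exp_eq_of_evMap_apply (Φ := μ.toLinearMap) ev hs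
  have nΔ := isNilpotent_of_evMap_apply_eq_zero ev hΔ
  have nσ := isNilpotent_of_evMap_apply_eq_zero ev hσ
  have he' : ∀ f, μ f = IsNilpotent.exp σ f := fun f => (LinearMap.congr_fun he f).symm
  refine ⟨Δ, σ, ⟨?_, ?_, ?_, ?_⟩, hΔ, hσ, rfl⟩
  · refine (exp_bilinear_iff (LinearMap.mul 𝒜 (𝒜 ⊗[𝕂] R)) nσ nσ nσ).1 fun f g => ?_
    simp only [← he', LinearMap.mul_apply', map_mul]
  · refine (exp_bilinear_iff (LiePairs.fmul 𝒜) nσ nΔ nΔ).1 fun f u => ?_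
    rw [← he', hf]
  · exact (exp_bilinear_iff (E.cartesian 𝒜).bracket nΔ nΔ nΔ).1 hb
  · refine (exp_bilinear_iff (vact 𝕂 R 𝒜 ∘ₗ (E.cartesian 𝒜).anchor) nΔ nσ nσ).1 fun u f => ?_
    rw [← he', ← he']
    exact ha u f

end LieAlgebroidStr

end SmallAut

/-! ## Graphs of `B`-valued forms -/

section Graph

variable {𝕂 : Type*} [Field 𝕂] {R : Type*} [CommRing R] [Algebra 𝕂 R]
  {ΓA : Type*} [AddCommGroup ΓA] [Module 𝕂 ΓA] [Module R ΓA] [IsScalarTower 𝕂 R ΓA]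
  {ΓL : Type*} [AddCommGroup ΓL] [Module 𝕂 ΓL] [Module R ΓL] [IsScalarTower 𝕂 R ΓL]
  {ΓB : Type*} [AddCommGroup ΓB] [Module 𝕂 ΓB] [Module R ΓB] [IsScalarTower 𝕂 R ΓB]
  (P : SplitPair 𝕂 R ΓA ΓL ΓB) {𝒜 : Type*} [CommRing 𝒜] [Algebra 𝕂 𝒜]

theorem formOp_eq_ext₂ (ξ : 𝒜 ⊗[𝕂] (ΓA →ₗ[R] ΓB)) :
    formOp ξ = ext₂ 𝒜 (LinearMap.restrictScalarsₗ 𝕂 R ΓA ΓB 𝕂) ξ := rfl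

theorem formOp_fmul (ξ : 𝒜 ⊗[𝕂] (ΓA →ₗ[R] ΓB)) (f : 𝒜 ⊗[𝕂] R) (a : 𝒜 ⊗[𝕂] ΓA) :
    formOp ξ (fmul 𝒜 f a) = fmul 𝒜 f (formOp ξ a) := by
  rw [formOp_eq_ext₂]
  induction ξ with
  | zero => simp
  | add ξ ξ' h h' => simp only [map_add, LinearMap.add_apply, h, h']
  | tmul r ξ =>
    induction f with
    | zero => simp
    | add f f' h h' => simp only [map_add, LinearMap.add_apply, h, h']
    | tmul s f =>
      induction a with
      | zero => simp
      | add a a' h h' => simp only [map_add, h, h']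
      | tmul t a => simp [ext₂_tmul, mul_left_comm]

theorem formOp_injective [Module.Finite 𝕂 𝒜] :
    Function.Injective (formOp : 𝒜 ⊗[𝕂] (ΓA →ₗ[R] ΓB) → 𝒜 ⊗[𝕂] ΓA →ₗ[𝒜] 𝒜 ⊗[𝕂] ΓB) := by
  intro ξ η h
  refine eq_of_coordMap_eq fun φ => LinearMap.ext fun a => ?_
  have h1 := congrArg (fun Ψ => coordMap ΓB φ (Ψ (1 ⊗ₜ a))) h
  simp only [formOp_eq_ext₂, coordMap_ext₂_left] at h1
  exact h1

namespace SplitPair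

variable (𝒜) in
/-- The extension `Γ(A_𝒜) → Γ(L_𝒜)` of `i`. -/
abbrev extI : 𝒜 ⊗[𝕂] ΓA →ₗ[𝒜] 𝒜 ⊗[𝕂] ΓL := (P.i.restrictScalars 𝕂).baseChange 𝒜

variable (𝒜) in
/-- The extension `Γ(B_𝒜) → Γ(L_𝒜)` of `j`. -/
abbrev extJ : 𝒜 ⊗[𝕂] ΓB →ₗ[𝒜] 𝒜 ⊗[𝕂] ΓL := (P.j.restrictScalars 𝕂).baseChange 𝒜

variable (𝒜) in
/-- The extension `Γ(L_𝒜) → Γ(A_𝒜)` of `prA`. -/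
abbrev extPrA : 𝒜 ⊗[𝕂] ΓL →ₗ[𝒜] 𝒜 ⊗[𝕂] ΓA := (P.prA.restrictScalars 𝕂).baseChange 𝒜

variable (𝒜) in
/-- The extension `Γ(L_𝒜) → Γ(B_𝒜)` of `prB`. -/
abbrev extPrB : 𝒜 ⊗[𝕂] ΓL →ₗ[𝒜] 𝒜 ⊗[𝕂] ΓB := (P.prB.restrictScalars 𝕂).baseChange 𝒜

theorem extPrA_extI (a : 𝒜 ⊗[𝕂] ΓA) : P.extPrA 𝒜 (P.extI 𝒜 a) = a :=
  LinearMap.congr_fun (f := P.extPrA 𝒜 ∘ₗ P.extI 𝒜) (g := LinearMap.id)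
    (hom_ext_one_tmul fun a => by simp [P.prA_i]) a

theorem extPrB_extJ (b : 𝒜 ⊗[𝕂] ΓB) : P.extPrB 𝒜 (P.extJ 𝒜 b) = b :=
  LinearMap.congr_fun (f := P.extPrB 𝒜 ∘ₗ P.extJ 𝒜) (g := LinearMap.id)
    (hom_ext_one_tmul fun b => by simp [P.prB_j]) b

theorem extPrB_extI (a : 𝒜 ⊗[𝕂] ΓA) : P.extPrB 𝒜 (P.extI 𝒜 a) = 0 :=
  LinearMap.congr_fun (f := P.extPrB 𝒜 ∘ₗ P.extI 𝒜) (g := 0)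
    (hom_ext_one_tmul fun a => by simp [P.prB_i]) a

theorem extPrA_extJ (b : 𝒜 ⊗[𝕂] ΓB) : P.extPrA 𝒜 (P.extJ 𝒜 b) = 0 :=
  LinearMap.congr_fun (f := P.extPrA 𝒜 ∘ₗ P.extJ 𝒜) (g := 0)
    (hom_ext_one_tmul fun b => by simp [P.prA_j]) b

theorem ext_decomp (l : 𝒜 ⊗[𝕂] ΓL) :
    P.extI 𝒜 (P.extPrA 𝒜 l) + P.extJ 𝒜 (P.extPrB 𝒜 l) = l :=
  LinearMap.congr_fun (f := P.extI 𝒜 ∘ₗ P.extPrA 𝒜 + P.extJ 𝒜 ∘ₗ P.extPrB 𝒜)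
    (g := LinearMap.id)
    (hom_ext_one_tmul fun l => by simp [← TensorProduct.tmul_add, P.decomp]) l

theorem graphMap_apply (ξ : 𝒜 ⊗[𝕂] (ΓA →ₗ[R] ΓB)) (a : 𝒜 ⊗[𝕂] ΓA) :
    P.graphMap ξ a = P.extI 𝒜 a + P.extJ 𝒜 (formOp ξ a) := rfl

theorem extPrA_graphMap (ξ : 𝒜 ⊗[𝕂] (ΓA →ₗ[R] ΓB)) (a : 𝒜 ⊗[𝕂] ΓA) :
    P.extPrA 𝒜 (P.graphMap ξ a) = a := by
  rw [graphMap_apply, map_add, extPrA_extI, extPrA_extJ, add_zero]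

theorem extPrB_graphMap (ξ : 𝒜 ⊗[𝕂] (ΓA →ₗ[R] ΓB)) (a : 𝒜 ⊗[𝕂] ΓA) :
    P.extPrB 𝒜 (P.graphMap ξ a) = formOp ξ a := by
  rw [graphMap_apply, map_add, extPrB_extI, extPrB_extJ, zero_add]

theorem graphMap_injective [Module.Finite 𝕂 𝒜] :
    Function.Injective (P.graphMap : 𝒜 ⊗[𝕂] (ΓA →ₗ[R] ΓB) → _) := by
  intro ξ η h
  refine formOp_injective (LinearMap.ext fun a => ?_)
  rw [← P.extPrB_graphMap, h, extPrB_graphMap]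

theorem graphMap_fmul (ξ : 𝒜 ⊗[𝕂] (ΓA →ₗ[R] ΓB)) (f : 𝒜 ⊗[𝕂] R) (a : 𝒜 ⊗[𝕂] ΓA) :
    P.graphMap ξ (fmul 𝒜 f a) = fmul 𝒜 f (P.graphMap ξ a) := by
  rw [graphMap_apply, graphMap_apply, formOp_fmul, map_add, extI, extJ, baseChange_fmul,
    baseChange_fmul]

theorem evMap_graphMap [IsLocalRing 𝒜] (ev : 𝒜 →ₐ[𝕂] 𝕂) {ξ : 𝒜 ⊗[𝕂] (ΓA →ₗ[R] ΓB)}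
    (hξ : ξ ∈ mPart 𝕂 𝒜 (ΓA →ₗ[R] ΓB)) (a : 𝒜 ⊗[𝕂] ΓA) :
    evMap ΓL ev (P.graphMap ξ a) = P.i (evMap ΓA ev a) := by
  rw [graphMap_apply, map_add, evMap_baseChange, evMap_baseChange, formOp_eq_ext₂, evMap_ext₂,
    (mem_mPart_iff ev).1 hξ]
  simp

/-! ### The Maurer–Cartan equation -/

/-- This and its two analogues evaluate the extended brackets in terms of operators on `𝒜`-sections.
Everything is `𝒜`-multilinear, so pure tensors suffice. -/
theorem ext_formD (X : 𝒜 ⊗[𝕂] (ΓA →ₗ[R] ΓB)) (a b : 𝒜 ⊗[𝕂] ΓA) :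
    extApp 𝒜 _ _ (extApp 𝒜 _ _ (P.formD.baseChange 𝒜 X) a) b =
      P.extPrB 𝒜 (ext₂ 𝒜 P.LL.bracket (P.extI 𝒜 a) (P.extJ 𝒜 (formOp X b)))
      - P.extPrB 𝒜 (ext₂ 𝒜 P.LL.bracket (P.extI 𝒜 b) (P.extJ 𝒜 (formOp X a)))
      - formOp X (ext₂ 𝒜 P.LA.bracket a b) := by
  rw [formOp_eq_ext₂]
  induction X with
  | zero => simp
  | add X X' h h' => simp only [map_add, LinearMap.add_apply, h, h']; abel
  | tmul r X =>
    induction a with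
    | zero => simp
    | add a a' h h' => simp only [map_add, LinearMap.add_apply, h, h']; abel
    | tmul s a =>
      induction b with
      | zero => simp
      | add b b' h h' => simp only [map_add, LinearMap.add_apply, h, h']; abel
      | tmul t b =>
        simp only [ext₂_tmul, extApp_tmul, LinearMap.baseChange_tmul,
          LinearMap.restrictScalars_apply, LinearMap.restrictScalarsₗ_apply]
        rw [show s * (r * t) = r * s * t by ring, show t * (r * s) = r * s * t by ring,
          ← mul_assoc, ← TensorProduct.tmul_sub, ← TensorProduct.tmul_sub]
        rfl

theorem ext_halfBr₂ (X Y : 𝒜 ⊗[𝕂] (ΓA →ₗ[R] ΓB)) (a b : 𝒜 ⊗[𝕂] ΓA) :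
    extApp 𝒜 _ _ (extApp 𝒜 _ _ (ext₂ 𝒜 P.halfBr₂ X Y) a) b =
      P.extPrB 𝒜 (ext₂ 𝒜 P.LL.bracket (P.extJ 𝒜 (formOp X a)) (P.extJ 𝒜 (formOp Y b)))
      - formOp X (P.extPrA 𝒜 (ext₂ 𝒜 P.LL.bracket (P.extJ 𝒜 (formOp Y a)) (P.extI 𝒜 b)))
      - formOp X (P.extPrA 𝒜 (ext₂ 𝒜 P.LL.bracket (P.extI 𝒜 a) (P.extJ 𝒜 (formOp Y b)))) := by
  rw [formOp_eq_ext₂, formOp_eq_ext₂]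
  induction X with
  | zero => simp
  | add X X' h h' => simp only [map_add, LinearMap.add_apply, h, h']; abel
  | tmul r X =>
    induction Y with
    | zero => simp
    | add Y Y' h h' => simp only [map_add, LinearMap.add_apply, h, h']; abel
    | tmul q Y =>
      induction a with
      | zero => simp
      | add a a' h h' => simp only [map_add, LinearMap.add_apply, h, h']; abel
      | tmul s a =>
        induction b with
        | zero => simp
        | add b b' h h' => simp only [map_add, h, h']; abel
        | tmul t b =>
          simp only [ext₂_tmul, extApp_tmul, LinearMap.baseChange_tmul,
            LinearMap.restrictScalars_apply, LinearMap.restrictScalarsₗ_apply]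
          rw [show r * s * (q * t) = r * q * s * t by ring,
            show r * (q * s * t) = r * q * s * t by ring,
            show r * (s * (q * t)) = r * q * s * t by ring,
            ← TensorProduct.tmul_sub, ← TensorProduct.tmul_sub]
          rfl

theorem ext_thirdBr₃ (X Y Z : 𝒜 ⊗[𝕂] (ΓA →ₗ[R] ΓB)) (a b : 𝒜 ⊗[𝕂] ΓA) :
    extApp 𝒜 _ _ (extApp 𝒜 _ _ (ext₃ 𝒜 P.thirdBr₃ X Y Z) a) b =
      - formOp X (P.extPrA 𝒜
          (ext₂ 𝒜 P.LL.bracket (P.extJ 𝒜 (formOp Y a)) (P.extJ 𝒜 (formOp Z b))))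
      - formOp X (P.extPrA 𝒜
          (ext₂ 𝒜 P.LL.bracket (P.extJ 𝒜 (formOp Z a)) (P.extJ 𝒜 (formOp Y b)))) := by
  rw [formOp_eq_ext₂, formOp_eq_ext₂, formOp_eq_ext₂, ext₃]
  induction X with
  | zero => simp
  | add X X' h h' => simp only [map_add, LinearMap.add_apply, h, h']; abel
  | tmul r X =>
    induction Y with
    | zero => simp
    | add Y Y' h h' => simp only [map_add, LinearMap.add_apply, h, h']; abel
    | tmul q Y =>
      induction Z with
      | zero => simp
      | add Z Z' h h' => simp only [map_add, LinearMap.add_apply, h, h']; abel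
      | tmul p Z =>
        induction a with
        | zero => simp
        | add a a' h h' => simp only [map_add, LinearMap.add_apply, h, h']; abel
        | tmul s a =>
          induction b with
          | zero => simp
          | add b b' h h' => simp only [map_add, h, h']; abel
          | tmul t b =>
            simp only [ext₂_tmul, extApp_tmul, LinearMap.baseChange_tmul,
              LinearMap.restrictScalars_apply, LinearMap.restrictScalarsₗ_apply]
            rw [show r * (q * s * (p * t)) = r * q * p * s * t by ring,
              show r * (p * s * (q * t)) = r * q * p * s * t by ring,
              ← TensorProduct.tmul_neg, ← TensorProduct.tmul_sub]
            rfl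

/-- Undoes the polarization. The diagonal identity is not additive in `X`, so the induction runs on
the polarized form with an independent `Y`. -/
theorem ext_formBr₂_self (X : 𝒜 ⊗[𝕂] (ΓA →ₗ[R] ΓB)) :
    ext₂ 𝒜 P.formBr₂ X X = (2 : 𝕂) • ext₂ 𝒜 P.halfBr₂ X X := by
  have h : ∀ Y : 𝒜 ⊗[𝕂] (ΓA →ₗ[R] ΓB),
      ext₂ 𝒜 P.formBr₂ X Y = ext₂ 𝒜 P.halfBr₂ X Y + ext₂ 𝒜 P.halfBr₂ Y X := by
    intro Y
    induction X with
    | zero => simp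
    | add X X' h h' => simp only [map_add, LinearMap.add_apply, h, h']; abel
    | tmul r X =>
      induction Y with
      | zero => simp
      | add Y Y' h h' => simp only [map_add, LinearMap.add_apply, h, h']; abel
      | tmul q Y =>
        simp only [ext₂_tmul]
        rw [mul_comm q, ← TensorProduct.tmul_add]
        rfl
  rw [h, two_smul]

theorem ext_formBr₃_self (X : 𝒜 ⊗[𝕂] (ΓA →ₗ[R] ΓB)) :
    ext₃ 𝒜 P.formBr₃ X X X = (3 : 𝕂) • ext₃ 𝒜 P.thirdBr₃ X X X := by
  have h : ∀ Y Z : 𝒜 ⊗[𝕂] (ΓA →ₗ[R] ΓB), ext₃ 𝒜 P.formBr₃ X Y Z =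
      ext₃ 𝒜 P.thirdBr₃ X Y Z + ext₃ 𝒜 P.thirdBr₃ Y X Z + ext₃ 𝒜 P.thirdBr₃ Z X Y := by
    intro Y Z
    simp only [ext₃]
    induction X with
    | zero => simp
    | add X X' h h' => simp only [map_add, LinearMap.add_apply, h, h']; abel
    | tmul r X =>
      induction Y with
      | zero => simp
      | add Y Y' h h' => simp only [map_add, LinearMap.add_apply, h, h']; abel
      | tmul q Y =>
        induction Z with
        | zero => simp
        | add Z Z' h h' => simp only [map_add, LinearMap.add_apply, h, h']; abel
        | tmul p Z =>
          simp only [ext₂_tmul, extApp_tmul]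
          rw [mul_comm q, show p * r * q = r * q * p by ring, ← TensorProduct.tmul_add,
            ← TensorProduct.tmul_add]
          rfl
  rw [h, show (3 : 𝕂) = 1 + 1 + 1 by norm_num, add_smul, add_smul, one_smul]

theorem ext_i_bracket (a b : 𝒜 ⊗[𝕂] ΓA) :
    P.extI 𝒜 (ext₂ 𝒜 P.LA.bracket a b) = ext₂ 𝒜 P.LL.bracket (P.extI 𝒜 a) (P.extI 𝒜 b) := by
  induction a with
  | zero => simp
  | add a a' h h' => simp only [map_add, LinearMap.add_apply, h, h']
  | tmul s a =>
    induction b with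
    | zero => simp
    | add b b' h h' => simp only [map_add, h, h']
    | tmul t b => simp [ext₂_tmul, P.i_bracket]

/-- For a Maurer–Cartan element `ξ`, the image of `I_ξ` is closed under the bracket. -/
theorem IsMaurerCartan.graphMap_bracket [CharZero 𝕂] [IsLocalRing 𝒜]
    {ξ : 𝒜 ⊗[𝕂] (ΓA →ₗ[R] ΓB)} (hξ : P.IsMaurerCartan ξ) (a b : 𝒜 ⊗[𝕂] ΓA) :
    P.graphMap ξ (P.extPrA 𝒜
      ((P.LL.cartesian 𝒜).bracket (P.graphMap ξ a) (P.graphMap ξ b))) =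
      (P.LL.cartesian 𝒜).bracket (P.graphMap ξ a) (P.graphMap ξ b) := by
  have h := hξ.2
  change P.formD.baseChange 𝒜 ξ + (2 : 𝕂)⁻¹ • ext₂ 𝒜 P.formBr₂ ξ ξ +
    (6 : 𝕂)⁻¹ • ext₃ 𝒜 P.formBr₃ ξ ξ ξ = 0 at h
  rw [ext_formBr₂_self, ext_formBr₃_self, smul_smul, smul_smul, inv_mul_cancel₀ two_ne_zero,
    one_smul, show (6 : 𝕂)⁻¹ * 3 = 2⁻¹ by norm_num] at h
  have h1 := congrArg (fun t => extApp 𝒜 _ _ (extApp 𝒜 _ _ t a) b) h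
  -- The two summands of `thirdBr₃` coincide on the diagonal, which uses up the remaining factor
  -- `2⁻¹` of `6⁻¹ * 3`.
  have hT : extApp 𝒜 _ _ (extApp 𝒜 _ _ ((2 : 𝕂)⁻¹ • ext₃ 𝒜 P.thirdBr₃ ξ ξ ξ) a) b =
      - formOp ξ (P.extPrA 𝒜
          (ext₂ 𝒜 P.LL.bracket (P.extJ 𝒜 (formOp ξ a)) (P.extJ 𝒜 (formOp ξ b)))) := by
    rw [LinearMap.map_smul_of_tower, LinearMap.smul_apply, LinearMap.map_smul_of_tower,
      LinearMap.smul_apply, ext_thirdBr₃, ← neg_add', ← two_smul 𝕂, smul_neg, smul_smul,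
      inv_mul_cancel₀ two_ne_zero, one_smul]
  simp only [map_add, LinearMap.add_apply, hT, ext_formD, ext_halfBr₂, map_zero,
    LinearMap.zero_apply] at h1
  -- A section `l` lies on the graph exactly when `prB l = ξ (prA l)`. For `l = [I_ξ a, I_ξ b]` the
  -- difference of the two sides, expanded, is the Maurer–Cartan expression at `(a, b)`.
  have h2 : P.extPrB 𝒜 ((P.LL.cartesian 𝒜).bracket (P.graphMap ξ a) (P.graphMap ξ b)) =
      formOp ξ (P.extPrA 𝒜
        ((P.LL.cartesian 𝒜).bracket (P.graphMap ξ a) (P.graphMap ξ b))) := by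
    rw [← sub_eq_zero, ← h1, P.LL.cartesian_bracket]
    have hsk := P.LL.cartesian_skew (P.extI 𝒜 b) (P.extJ 𝒜 (formOp ξ a))
    rw [P.LL.cartesian_bracket] at hsk
    simp only [graphMap_apply, map_add, LinearMap.add_apply, ← ext_i_bracket, extPrA_extI,
      extPrB_extI, hsk, map_neg]
    abel
  conv_rhs => rw [← P.ext_decomp ((P.LL.cartesian 𝒜).bracket _ _), h2]
  rfl

theorem standard_bracket (ξ : 𝒜 ⊗[𝕂] (ΓA →ₗ[R] ΓB)) (a b : 𝒜 ⊗[𝕂] ΓA) :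
    (P.standard ξ).str.bracket a b =
      P.extPrA 𝒜 ((P.LL.cartesian 𝒜).bracket (P.graphMap ξ a) (P.graphMap ξ b)) := rfl

theorem standard_anchor (ξ : 𝒜 ⊗[𝕂] (ΓA →ₗ[R] ΓB)) (a : 𝒜 ⊗[𝕂] ΓA) :
    (P.standard ξ).str.anchor a = (P.LL.cartesian 𝒜).anchor (P.graphMap ξ a) := rfl

/-- `prA` inverts `I_ξ` on its graph, which is closed under the bracket, so the axioms are inherited
from `L⁰_𝒜`. The centers are right because `ξ` vanishes under evaluation. -/
theorem IsMaurerCartan.isInfinitesimalDeformation [CharZero 𝕂] [IsLocalRing 𝒜]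
    (ev : 𝒜 →ₐ[𝕂] 𝕂) {ξ : 𝒜 ⊗[𝕂] (ΓA →ₗ[R] ΓB)} (hξ : P.IsMaurerCartan ξ) :
    P.IsInfinitesimalDeformation ev (P.standard ξ) := by
  have hE := P.LL.cartesian_isLieAlgebroid (𝒜 := 𝒜)
  refine ⟨⟨fun f u => ?_, fun u => ?_, fun u v w => ?_, fun u f v => ?_⟩,
    ⟨fun u v => ?_, fun u => ?_⟩, ⟨fun f => ?_, P.graphMap_fmul ξ, fun u v => ?_, fun u f => rfl⟩,
    fun a => ?_⟩
  · rw [standard_anchor, graphMap_fmul, hE.anchor_fmul, standard_anchor]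
  · rw [standard_bracket, hE.bracket_self, map_zero]
  · simp only [standard_bracket, hξ.graphMap_bracket]
    rw [hE.jacobi, map_add]
  · rw [standard_bracket, graphMap_fmul, hE.leibniz, map_add, extPrA, baseChange_fmul,
      baseChange_fmul, extPrA_graphMap]
    rfl
  · rw [standard_bracket, evMap_baseChange, P.LL.cartesian_bracket, evMap_ext₂,
      P.evMap_graphMap ev hξ.1, P.evMap_graphMap ev hξ.1]
    simp [← P.i_bracket, P.prA_i]
  · rw [standard_anchor, P.LL.cartesian_anchor, evMap_baseChange, P.evMap_graphMap ev hξ.1]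
    simp [P.i_anchor]
  · simp [standard]
  · exact (hξ.graphMap_bracket P u v)
  · exact (P.evMap_graphMap ev hξ.1 _).trans (by simp)

end SplitPair

end Graph

/-! ## The gauge action and exponentials of derivations -/

section AbstractGauge

variable {𝕂 : Type*} [Field 𝕂] [CharZero 𝕂] {𝒜 : Type*} [CommRing 𝒜] [Algebra 𝕂 𝒜]
  {g₀ g₁ g₂ : Type*} [AddCommGroup g₀] [Module 𝕂 g₀] [AddCommGroup g₁] [Module 𝕂 g₁]
  [AddCommGroup g₂] [Module 𝕂 g₂] (C : CubicBrackets 𝕂 g₀ g₁ g₂)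
  {S : Type*} [Ring S] [Module 𝕂 S] [Module ℚ S] (hat : 𝒜 ⊗[𝕂] g₁ →ₗ[𝕂] S)

/-- The convention `e^0_ξ(b) = -ξ` absorbs the leading `ξ` into a uniform Taylor sum. -/
theorem CubicBrackets.map_expAct (ξ : 𝒜 ⊗[𝕂] g₁) (b : 𝒜 ⊗[𝕂] g₀) {N : ℕ}
    (hN : ∀ n, N ≤ n → C.expTerm ξ b (n + 1) = 0) :
    hat (C.expAct b ξ) = ∑ n ∈ Finset.range (N + 1),
      (n.factorial : ℚ)⁻¹ • -hat (C.expTerm ξ b n) := by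
  rw [CubicBrackets.expAct, finsum_eq_sum_of_support_subset (s := Finset.range N), map_sub,
    map_sum, Finset.sum_range_succ', CubicBrackets.expTerm, map_neg, neg_neg, Nat.factorial_zero,
    Nat.cast_one, inv_one, one_smul, add_comm, sub_eq_add_neg, ← Finset.sum_neg_distrib]
  · congr 1
    refine Finset.sum_congr rfl fun n _ => ?_
    rw [map_smul, ← smul_neg, ← Rat.cast_smul_eq_qsmul 𝕂]
    push_cast
    rfl
  · intro n hn
    by_contra h
    refine hn ?_
    simp only [hN n (by simpa using h), smul_zero]

/-- If the brackets of a cubic `L_∞`-algebra are those of the Riccati equation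
`x' = (q - x) D (p + x)` in a ring `S`, then `exp D` maps the graph of `ξ` onto that of
`e^b * ξ`. -/
theorem CubicBrackets.exp_mul_graph {h : 𝒜 ⊗[𝕂] g₁ → S} (hadd : ∀ X Y, h (X + Y) = h X + h Y)
    (hsmul : ∀ (r : 𝕂) X, h (r • X) = r • h X) (ξ : 𝒜 ⊗[𝕂] g₁) (b : 𝒜 ⊗[𝕂] g₀) {p q D : S}
    (hpq : p + q = 1) (hqp : q * p = 0) (hqX : ∀ X, q * h X = h X)
    (hXp : ∀ X, h X * p = h X) (h₀ : h (C.d₀.baseChange 𝒜 b) = -(q * D * p))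
    (h₁ : ∀ X, h (ext₂ 𝒜 C.br₀₁ b X) = q * D * h X - h X * D * p)
    (h₂ : ∀ X Y, h (ext₃ 𝒜 C.br₀₁₁ b X Y) = h Y * D * h X + h X * D * h Y)
    (hD : IsNilpotent D) {N : ℕ} (hN : ∀ n, N ≤ n → C.expTerm ξ b (n + 1) = 0) :
    IsNilpotent.exp D * (p + h ξ) =
      (p + h (C.expAct b ξ)) * (p * IsNilpotent.exp D * (p + h ξ)) := by
  obtain ⟨hat, rfl⟩ : ∃ hat : 𝒜 ⊗[𝕂] g₁ →ₗ[𝕂] S, ⇑hat = h :=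
    ⟨{ toFun := h, map_add' := hadd, map_smul' := hsmul }, rfl⟩
  let c : ℕ → S := fun n => -hat (C.expTerm ξ b n)
  have hc0 : c 0 = hat ξ := by
    simp only [c, CubicBrackets.expTerm, map_neg, neg_neg]
  rw [C.map_expAct hat ξ b hN, ← hc0]
  refine LiePairs.exp_mul_graph (c := c) hpq hqp (fun n => by rw [mul_neg, hqX])
    (fun n => by rw [neg_mul, hXp]) hD (fun n hn => ?_) ?_ fun n => ?_
  · obtain ⟨n, rfl⟩ : ∃ m, n = m + 1 := ⟨n - 1, by omega⟩
    simp only [c, hN n (by omega), map_zero, neg_zero]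
  · rw [hc0]
    simp only [c, CubicBrackets.expTerm, CubicBrackets.twisted₁, map_add, map_sub, map_smul,
      h₀, h₁, h₂]
    rw [← two_smul 𝕂, smul_smul, inv_mul_cancel₀ two_ne_zero, one_smul]
    noncomm_ring
  -- The extremal terms, where one factor is `c 0 = hat ξ`, give the `ξ`-twist of the binary
  -- bracket; the interior ones give the sum of ternary brackets.
  · have hs := sum_antidiagonal_succ_symm (𝕂 := 𝕂) (fun k l => c k * D * c l) n
    have hq : ∀ (k : ℕ) (x : S), (k : ℚ) • x = (k : 𝕂) • x :=
      fun k x => by rw [Nat.cast_smul_eq_nsmul, Nat.cast_smul_eq_nsmul]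
    simp only [hq, hs, hc0]
    simp only [c, CubicBrackets.expTerm, CubicBrackets.twisted₂, CubicBrackets.twisted₃, map_add,
      map_sub, map_sum, map_smul, h₁, h₂, neg_mul, mul_neg, neg_neg]
    abel

end AbstractGauge

/-! ### The gauge action of a Lie pair and the comparison of the two equivalences -/

section Gauge

variable {𝕂 : Type*} [Field 𝕂] {R : Type*} [CommRing R] [Algebra 𝕂 R]
  {ΓA : Type*} [AddCommGroup ΓA] [Module 𝕂 ΓA] [Module R ΓA] [IsScalarTower 𝕂 R ΓA]
  {ΓL : Type*} [AddCommGroup ΓL] [Module 𝕂 ΓL] [Module R ΓL] [IsScalarTower 𝕂 R ΓL]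
  {ΓB : Type*} [AddCommGroup ΓB] [Module 𝕂 ΓB] [Module R ΓB] [IsScalarTower 𝕂 R ΓB]
  (P : SplitPair 𝕂 R ΓA ΓL ΓB) {𝒜 : Type*} [CommRing 𝒜] [Algebra 𝕂 𝒜]

namespace SplitPair

/-- The derivation `δ + [j b, -]` of `L` through which `(δ, b) ∈ Der(L) ⊕ Γ(B)` acts. -/
def totalDer : P.LL.Der × ΓB →ₗ[𝕂] P.LL.Der :=
  LinearMap.id.coprod (P.LL.ad ∘ₗ P.j.restrictScalars 𝕂)

theorem totalDer_apply (δ : P.LL.Der × ΓB) (l : ΓL) :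
    (P.totalDer δ).1.1 l = δ.1.1.1 l + P.LL.bracket (P.j δ.2) l := rfl

/-- The operator on `Γ(L_𝒜)` given by an element of `(Der(L) ⊕ Γ(B)) ⊗ 𝒜`. -/
def gaugeOp (b : 𝒜 ⊗[𝕂] (P.LL.Der × ΓB)) : Module.End 𝒜 (𝒜 ⊗[𝕂] ΓL) :=
  ext₂ 𝒜 P.LL.derOp (P.totalDer.baseChange 𝒜 b)

/-- Skew-symmetry turns `prB [a, j b]` into `-prB [j b, a]`, so the formulas for `Der(L)` and `Γ(B)`
merge into one for the total derivation. -/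
theorem extended_d₀_apply (δ : P.LL.Der × ΓB) (a : ΓA) :
    P.extended.d₀ δ a = -P.prB ((P.totalDer δ).1.1 (P.i a)) := by
  rw [totalDer_apply, P.LL.skew (P.j δ.2), map_add, map_neg, neg_add, neg_neg]
  rfl

theorem extended_br₀₁_apply (δ : P.LL.Der × ΓB) (X : ΓA →ₗ[R] ΓB) (a : ΓA) :
    P.extended.br₀₁ δ X a = P.prB ((P.totalDer δ).1.1 (P.j (X a))) -
      X (P.prA ((P.totalDer δ).1.1 (P.i a))) := by
  simp only [totalDer_apply, map_add, add_sub_add_comm]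
  rfl

theorem extended_br₀₁₁_apply (δ : P.LL.Der × ΓB) (X Y : ΓA →ₗ[R] ΓB) (a : ΓA) :
    P.extended.br₀₁₁ δ X Y a = Y (P.prA ((P.totalDer δ).1.1 (P.j (X a)))) +
      X (P.prA ((P.totalDer δ).1.1 (P.j (Y a)))) := by
  simp only [totalDer_apply, map_add]
  rw [add_add_add_comm]
  rfl

theorem formOp_d₀ (b : 𝒜 ⊗[𝕂] (P.LL.Der × ΓB)) (a : 𝒜 ⊗[𝕂] ΓA) :
    formOp (P.extended.d₀.baseChange 𝒜 b) a = -P.extPrB 𝒜 (P.gaugeOp b (P.extI 𝒜 a)) := by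
  rw [formOp_eq_ext₂, gaugeOp]
  induction b with
  | zero => simp
  | add b b' h h' => simp only [map_add, LinearMap.add_apply, h, h']; abel
  | tmul r δ =>
    induction a with
    | zero => simp
    | add a a' h h' => simp only [map_add, h, h']; abel
    | tmul s a =>
      simp only [LinearMap.baseChange_tmul, ext₂_tmul, LinearMap.restrictScalars_apply,
        LinearMap.restrictScalarsₗ_apply, extended_d₀_apply, LieAlgebroidStr.derOp_apply,
        TensorProduct.tmul_neg]

theorem formOp_br₀₁ (b : 𝒜 ⊗[𝕂] (P.LL.Der × ΓB)) (X : 𝒜 ⊗[𝕂] (ΓA →ₗ[R] ΓB)) (a : 𝒜 ⊗[𝕂] ΓA) :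
    formOp (ext₂ 𝒜 P.extended.br₀₁ b X) a =
      P.extPrB 𝒜 (P.gaugeOp b (P.extJ 𝒜 (formOp X a))) -
        formOp X (P.extPrA 𝒜 (P.gaugeOp b (P.extI 𝒜 a))) := by
  rw [formOp_eq_ext₂, formOp_eq_ext₂, gaugeOp]
  induction b with
  | zero => simp
  | add b b' h h' => simp only [map_add, LinearMap.add_apply, h, h']; abel
  | tmul r δ =>
    induction X with
    | zero => simp
    | add X X' h h' => simp only [map_add, LinearMap.add_apply, h, h']; abel
    | tmul q X =>
      induction a with
      | zero => simp
      | add a a' h h' => simp only [map_add, h, h']; abel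
      | tmul s a =>
        simp only [LinearMap.baseChange_tmul, ext₂_tmul, LinearMap.restrictScalars_apply,
          LinearMap.restrictScalarsₗ_apply, extended_br₀₁_apply, LieAlgebroidStr.derOp_apply,
          TensorProduct.tmul_sub]
        rw [← mul_assoc, mul_left_comm q r s, ← mul_assoc]

theorem formOp_br₀₁₁ (b : 𝒜 ⊗[𝕂] (P.LL.Der × ΓB)) (X Y : 𝒜 ⊗[𝕂] (ΓA →ₗ[R] ΓB))
    (a : 𝒜 ⊗[𝕂] ΓA) :
    formOp (ext₃ 𝒜 P.extended.br₀₁₁ b X Y) a =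
      formOp Y (P.extPrA 𝒜 (P.gaugeOp b (P.extJ 𝒜 (formOp X a)))) +
        formOp X (P.extPrA 𝒜 (P.gaugeOp b (P.extJ 𝒜 (formOp Y a)))) := by
  rw [formOp_eq_ext₂, formOp_eq_ext₂, formOp_eq_ext₂, gaugeOp, ext₃]
  induction b with
  | zero => simp
  | add b b' h h' => simp only [map_add, LinearMap.add_apply, h, h']; abel
  | tmul r δ =>
    induction X with
    | zero => simp
    | add X X' h h' => simp only [map_add, LinearMap.add_apply, h, h']; abel
    | tmul q X =>
      induction Y with
      | zero => simp
      | add Y Y' h h' => simp only [map_add, LinearMap.add_apply, h, h']; abel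
      | tmul p Y =>
        induction a with
        | zero => simp
        | add a a' h h' => simp only [map_add, h, h']; abel
        | tmul s a =>
          simp only [LinearMap.baseChange_tmul, ext₂_tmul, extApp_tmul,
            LinearMap.restrictScalars_apply, LinearMap.restrictScalarsₗ_apply,
            extended_br₀₁₁_apply, LieAlgebroidStr.derOp_apply, TensorProduct.tmul_add]
          rw [show p * (r * (q * s)) = r * q * p * s by ring,
            show q * (r * (p * s)) = r * q * p * s by ring]

/-- A form `X ∈ Γ(A* ⊗ B) ⊗ 𝒜` as the endomorphism `j ∘ X ∘ prA` of `Γ(L_𝒜)`. -/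
def hat (X : 𝒜 ⊗[𝕂] (ΓA →ₗ[R] ΓB)) : Module.End 𝒜 (𝒜 ⊗[𝕂] ΓL) :=
  P.extJ 𝒜 ∘ₗ formOp X ∘ₗ P.extPrA 𝒜

theorem hat_add (X Y : 𝒜 ⊗[𝕂] (ΓA →ₗ[R] ΓB)) : P.hat (X + Y) = P.hat X + P.hat Y := by
  simp only [hat, formOp_eq_ext₂, map_add, LinearMap.comp_add, LinearMap.add_comp]

theorem hat_smul (c : 𝕂) (X : 𝒜 ⊗[𝕂] (ΓA →ₗ[R] ΓB)) : P.hat (c • X) = c • P.hat X := by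
  refine LinearMap.ext fun l => ?_
  simp only [hat, formOp_eq_ext₂, LinearMap.map_smul_of_tower, LinearMap.comp_apply,
    LinearMap.smul_apply]

theorem hat_apply (X : 𝒜 ⊗[𝕂] (ΓA →ₗ[R] ΓB)) (l : 𝒜 ⊗[𝕂] ΓL) :
    P.hat X l = P.extJ 𝒜 (formOp X (P.extPrA 𝒜 l)) := rfl

variable (𝒜) in
/-- The projection `i ∘ prA` of `Γ(L_𝒜)`. -/
def projA : Module.End 𝒜 (𝒜 ⊗[𝕂] ΓL) := P.extI 𝒜 ∘ₗ P.extPrA 𝒜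

variable (𝒜) in
/-- The projection `j ∘ prB` of `Γ(L_𝒜)`. -/
def projB : Module.End 𝒜 (𝒜 ⊗[𝕂] ΓL) := P.extJ 𝒜 ∘ₗ P.extPrB 𝒜

theorem projA_apply (l : 𝒜 ⊗[𝕂] ΓL) : P.projA 𝒜 l = P.extI 𝒜 (P.extPrA 𝒜 l) := rfl

theorem projB_apply (l : 𝒜 ⊗[𝕂] ΓL) : P.projB 𝒜 l = P.extJ 𝒜 (P.extPrB 𝒜 l) := rfl

theorem projA_add_projB : P.projA 𝒜 + P.projB 𝒜 = 1 := LinearMap.ext P.ext_decomp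

theorem projB_mul_projA : P.projB 𝒜 * P.projA 𝒜 = 0 := by
  refine LinearMap.ext fun l => ?_
  rw [Module.End.mul_apply, projB_apply, projA_apply, extPrB_extI, map_zero]
  rfl

theorem projB_mul_hat (X : 𝒜 ⊗[𝕂] (ΓA →ₗ[R] ΓB)) : P.projB 𝒜 * P.hat X = P.hat X := by
  refine LinearMap.ext fun l => ?_
  rw [Module.End.mul_apply, projB_apply, hat_apply, extPrB_extJ]

theorem hat_mul_projA (X : 𝒜 ⊗[𝕂] (ΓA →ₗ[R] ΓB)) : P.hat X * P.projA 𝒜 = P.hat X := by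
  refine LinearMap.ext fun l => ?_
  rw [Module.End.mul_apply, projA_apply, hat_apply, hat_apply, extPrA_extI]

theorem hat_d₀ (b : 𝒜 ⊗[𝕂] (P.LL.Der × ΓB)) :
    P.hat (P.extended.d₀.baseChange 𝒜 b) = -(P.projB 𝒜 * P.gaugeOp b * P.projA 𝒜) := by
  refine LinearMap.ext fun l => ?_
  rw [hat_apply, formOp_d₀, map_neg]
  rfl

theorem hat_br₀₁ (b : 𝒜 ⊗[𝕂] (P.LL.Der × ΓB)) (X : 𝒜 ⊗[𝕂] (ΓA →ₗ[R] ΓB)) :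
    P.hat (ext₂ 𝒜 P.extended.br₀₁ b X) =
      P.projB 𝒜 * P.gaugeOp b * P.hat X - P.hat X * P.gaugeOp b * P.projA 𝒜 := by
  refine LinearMap.ext fun l => ?_
  rw [hat_apply, formOp_br₀₁, map_sub]
  rfl

theorem hat_br₀₁₁ (b : 𝒜 ⊗[𝕂] (P.LL.Der × ΓB)) (X Y : 𝒜 ⊗[𝕂] (ΓA →ₗ[R] ΓB)) :
    P.hat (ext₃ 𝒜 P.extended.br₀₁₁ b X Y) =
      P.hat Y * P.gaugeOp b * P.hat X + P.hat X * P.gaugeOp b * P.hat Y := by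
  refine LinearMap.ext fun l => ?_
  rw [hat_apply, formOp_br₀₁₁, map_add]
  rfl

theorem graphMap_eq_apply_extI (ξ : 𝒜 ⊗[𝕂] (ΓA →ₗ[R] ΓB)) (a : 𝒜 ⊗[𝕂] ΓA) :
    P.graphMap ξ a = (P.projA 𝒜 + P.hat ξ) (P.extI 𝒜 a) := by
  rw [LinearMap.add_apply, projA_apply, hat_apply, extPrA_extI, graphMap_apply]

theorem evMap_gaugeOp [IsLocalRing 𝒜] (ev : 𝒜 →ₐ[𝕂] 𝕂) {b : 𝒜 ⊗[𝕂] (P.LL.Der × ΓB)}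
    (hb : b ∈ mPart 𝕂 𝒜 (P.LL.Der × ΓB)) (l : 𝒜 ⊗[𝕂] ΓL) :
    evMap ΓL ev (P.gaugeOp b l) = 0 := by
  rw [gaugeOp, evMap_ext₂, evMap_baseChange, (mem_mPart_iff ev).1 hb]
  simp

variable [CharZero 𝕂] [IsLocalRing 𝒜] [IsArtinianRing 𝒜]

theorem exists_expTerm_eq_zero (ξ : 𝒜 ⊗[𝕂] (ΓA →ₗ[R] ΓB)) {b : 𝒜 ⊗[𝕂] (P.LL.Der × ΓB)}
    (hb : b ∈ mPart 𝕂 𝒜 (P.LL.Der × ΓB)) :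
    ∃ N, ∀ n, N ≤ n → P.extended.expTerm ξ b (n + 1) = 0 := by
  obtain ⟨N, hN⟩ := maximalIdeal_pow_eq_zero 𝒜
  refine ⟨N, fun n hn => ?_⟩
  have h := P.extended.expTerm_mem ξ hb n
  rwa [le_bot_iff.1 ((Ideal.pow_le_pow_right (by omega : N ≤ n + 1)).trans hN.le),
    Submodule.bot_smul, Submodule.mem_bot] at h

/-- The Riccati argument in the ring of endomorphisms of `Γ(L_𝒜)`, with `hat_d₀`, `hat_br₀₁` and
`hat_br₀₁₁` as the dictionary for the brackets. -/
theorem exp_gaugeOp_mul [Module ℚ (𝒜 ⊗[𝕂] ΓL)] (ev : 𝒜 →ₐ[𝕂] 𝕂)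
    (ξ : 𝒜 ⊗[𝕂] (ΓA →ₗ[R] ΓB)) {b : 𝒜 ⊗[𝕂] (P.LL.Der × ΓB)}
    (hb : b ∈ mPart 𝕂 𝒜 (P.LL.Der × ΓB)) :
    IsNilpotent.exp (P.gaugeOp b) * (P.projA 𝒜 + P.hat ξ) =
      (P.projA 𝒜 + P.hat (P.extended.expAct b ξ)) *
        (P.projA 𝒜 * IsNilpotent.exp (P.gaugeOp b) * (P.projA 𝒜 + P.hat ξ)) := by
  obtain ⟨N, hE⟩ := P.exists_expTerm_eq_zero ξ hb
  have hnil : IsNilpotent (P.gaugeOp b) :=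
    isNilpotent_of_evMap_apply_eq_zero ev fun l => P.evMap_gaugeOp ev hb _
  have key := CubicBrackets.exp_mul_graph (S := Module.End 𝒜 (𝒜 ⊗[𝕂] ΓL)) (C := P.extended)
    (h := P.hat) (ξ := ξ) (b := b) (p := P.projA 𝒜) (q := P.projB 𝒜) (D := P.gaugeOp b)
    P.hat_add P.hat_smul P.projA_add_projB P.projB_mul_projA P.projB_mul_hat P.hat_mul_projA
    (P.hat_d₀ b) (P.hat_br₀₁ b) (P.hat_br₀₁₁ b) hnil hE
  exact key

/-- The exponential of a derivation maps the graph of `ξ` onto the graph of `e^b * ξ`. -/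
theorem exp_gaugeOp_graphMap [Module ℚ (𝒜 ⊗[𝕂] ΓL)] (ev : 𝒜 →ₐ[𝕂] 𝕂)
    (ξ : 𝒜 ⊗[𝕂] (ΓA →ₗ[R] ΓB)) {b : 𝒜 ⊗[𝕂] (P.LL.Der × ΓB)}
    (hb : b ∈ mPart 𝕂 𝒜 (P.LL.Der × ΓB)) (a : 𝒜 ⊗[𝕂] ΓA) :
    IsNilpotent.exp (P.gaugeOp b) (P.graphMap ξ a) =
      P.graphMap (P.extended.expAct b ξ)
        (P.extPrA 𝒜 (IsNilpotent.exp (P.gaugeOp b) (P.graphMap ξ a))) := by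
  have h := LinearMap.congr_fun (P.exp_gaugeOp_mul ev ξ hb) (P.extI 𝒜 a)
  simp only [Module.End.mul_apply, ← graphMap_eq_apply_extI, projA_apply] at h
  exact h

/-- A small automorphism which maps the graph of `η` to the graph of `ξ` induces a morphism
between the sources of the standard deformations. -/
theorem isRingedHom_of_comp_graphMap (ev : 𝒜 →ₐ[𝕂] 𝕂) {ξ η : 𝒜 ⊗[𝕂] (ΓA →ₗ[R] ΓB)}
    (hη : P.IsMaurerCartan η) {Φ : Module.End 𝒜 (𝒜 ⊗[𝕂] ΓL)} {μ : 𝒜 ⊗[𝕂] R →ₐ[𝒜] 𝒜 ⊗[𝕂] R}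
    (hΦ : P.LL.IsSmallAut ev Φ μ) {ψ : Module.End 𝒜 (𝒜 ⊗[𝕂] ΓA)}
    (h : ∀ a, Φ (P.graphMap η a) = P.graphMap ξ (ψ a)) :
    IsRingedHom ev (P.standard η).str (P.standard ξ).str ψ μ := by
  have hψ : ∀ a, ψ a = P.extPrA 𝒜 (Φ (P.graphMap η a)) := fun a => by
    rw [h, extPrA_graphMap]
  refine ⟨hΦ.1.small, fun f u => ?_, fun u v => ?_, fun u f => ?_⟩
  · rw [hψ, graphMap_fmul, hΦ.1.map_fmul, extPrA, baseChange_fmul, ← hψ]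
  · rw [hψ, standard_bracket, hη.graphMap_bracket, hΦ.1.map_bracket, h, h]
    rfl
  · rw [standard_anchor, standard_anchor, hΦ.1.map_anchor, h]

theorem IsMaurerCartan.gaugeEquivalent_iff [Module ℚ (𝒜 ⊗[𝕂] ΓL)] [Module ℚ (𝒜 ⊗[𝕂] R)]
    (ev : 𝒜 →ₐ[𝕂] 𝕂) {ξ η : 𝒜 ⊗[𝕂] (ΓA →ₗ[R] ΓB)} (hξ : P.IsMaurerCartan ξ)
    (hη : P.IsMaurerCartan η) :
    P.GaugeEquivalent ξ η ↔ P.WeaklyIsomorphic ev (P.standard ξ) (P.standard η) := by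
  have hfin := finite_of_isArtinianRing ev
  constructor
  · rintro ⟨b, hb, rfl⟩
    set D := P.totalDer.baseChange 𝒜 b with hD
    set Δ := P.gaugeOp b
    have hev : ∀ l, evMap ΓL ev (Δ l) = 0 := P.evMap_gaugeOp ev hb
    have hnil : IsNilpotent Δ := isNilpotent_of_evMap_apply_eq_zero ev fun l => hev _
    -- The sign reverses the direction: `exp Δ` maps the graph of `ξ` to that of `η`, while a weak
    -- isomorphism needs a map from the graph of `η` to that of `ξ`.
    have hder : P.LL.IsExtDer (-Δ) (ext₂ 𝒜 P.LL.derSymb (-D)) := by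
      have := P.LL.isExtDer_ext₂ (-D)
      rwa [map_neg] at this
    obtain ⟨μ, hμ⟩ := hder.exp_isSmallAut ev
      (fun l => by rw [LinearMap.neg_apply, map_neg, hev, neg_zero])
      (fun f => by
        rw [evMap_ext₂, map_neg, hD, evMap_baseChange, (mem_mPart_iff ev).1 hb]
        simp)
    -- The reparametrization of `A_𝒜` induced by `exp Δ`. Its center is `prA i = id`, so it is
    -- unipotent; a right inverse `ψ` is the required morphism between the sources.
    let φ : Module.End 𝒜 (𝒜 ⊗[𝕂] ΓA) :=
      P.extPrA 𝒜 ∘ₗ IsNilpotent.exp Δ ∘ₗ P.graphMap ξ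
    have hφ : IsNilpotent (φ - 1) := isNilpotent_of_evMap_apply_eq_zero ev fun a => by
      rw [LinearMap.sub_apply, map_sub, LinearMap.comp_apply, LinearMap.comp_apply,
        evMap_baseChange, evMap_exp_apply ev (fun l => hev _), P.evMap_graphMap ev hξ.1]
      simp [P.prA_i]
    have hunit : IsUnit φ := by
      have := IsNilpotent.isUnit_add_one (R := Module.End 𝒜 (𝒜 ⊗[𝕂] ΓA)) hφ
      have h1 : φ - 1 + 1 = φ := sub_add_cancel φ 1
      exact h1 ▸ this
    obtain ⟨ψ, hψ⟩ := hunit.exists_right_inv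
    have hcomp : ∀ a, IsNilpotent.exp (-Δ) (P.graphMap (P.extended.expAct b ξ) a) =
        P.graphMap ξ (ψ a) := fun a => by
      have h1 := P.exp_gaugeOp_graphMap ev ξ hb (ψ a)
      have h2 : P.extPrA 𝒜 (IsNilpotent.exp Δ (P.graphMap ξ (ψ a))) = a :=
        LinearMap.congr_fun hψ a
      rw [h2] at h1
      rw [← h1, ← Module.End.mul_apply, IsNilpotent.exp_neg_mul_exp_self hnil,
        Module.End.one_apply]
    exact ⟨_, μ, hμ, ψ, μ, P.isRingedHom_of_comp_graphMap ev hη hμ hcomp, LinearMap.ext hcomp,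
      rfl⟩
  · rintro ⟨Φ, μ, hΦ, ψ, -, -, hcomp, -⟩
    obtain ⟨Δ, σ, hder, hev, hevσ, rfl⟩ := hΦ.exists_exp_eq ev
    have hnil : IsNilpotent Δ := isNilpotent_of_evMap_apply_eq_zero ev hev
    obtain ⟨D, rfl, rfl⟩ := hder.exists_eq
    -- An element of `Der(L)` is determined by its operator and its symbol, and both evaluate to
    -- zero.
    have hDev : evMap P.LL.Der ev D = 0 := by
      refine Subtype.ext (Prod.ext (LinearMap.ext fun u => ?_) (Derivation.ext fun f => ?_))
      · have := hev u
        rwa [evMap_ext₂, evMap_tmul, map_one, one_smul] at this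
      · have := hevσ f
        rwa [evMap_ext₂, evMap_tmul, map_one, one_smul] at this
    -- The gauge element is `(-D, 0)`: the summand `Der(L)` alone yields every small automorphism.
    set b : 𝒜 ⊗[𝕂] (P.LL.Der × ΓB) := -(LinearMap.inl 𝕂 P.LL.Der ΓB).baseChange 𝒜 D with hbD
    have hb : b ∈ mPart 𝕂 𝒜 (P.LL.Der × ΓB) := by
      rw [mem_mPart_iff ev, hbD, map_neg, evMap_baseChange, hDev, map_zero, neg_zero]
    have hgb : P.gaugeOp b = -ext₂ 𝒜 P.LL.derOp D := by
      rw [gaugeOp, hbD, map_neg, map_neg, ← LinearMap.comp_apply (f := LinearMap.baseChange _ _),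
        ← LinearMap.baseChange_comp, totalDer, LinearMap.coprod_inl, LinearMap.baseChange_id]
      rfl
    refine ⟨b, hb, P.graphMap_injective (LinearMap.ext fun a => ?_)⟩
    -- Since `exp (-Δ)` undoes `Φ`, the left side becomes `I_η a` and the argument on the right
    -- becomes `prA (I_η a) = a`. So `I_η` and `I_{e^b * ξ}` agree, and a form is determined by its
    -- graph.
    have h1 := P.exp_gaugeOp_graphMap ev ξ hb (ψ a)
    have h2 : IsNilpotent.exp (ext₂ 𝒜 P.LL.derOp D) (P.graphMap η a) = P.graphMap ξ (ψ a) :=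
      LinearMap.congr_fun hcomp a
    rw [← h2, hgb, ← Module.End.mul_apply, IsNilpotent.exp_neg_mul_exp_self hnil,
      Module.End.one_apply, extPrA_graphMap] at h1
    exact h1

end SplitPair

end Gauge

end LiePairs

end

/-- The geometry enters only through modules of sections over `C^∞(M, 𝕂)`, where the argument is
purely algebraic. -/
theorem mainTheorem4 {𝕂 : Type*} [RCLike 𝕂]
    {n : ℕ} {M : Type*} [TopologicalSpace M] [ChartedSpace (EuclideanSpace ℝ (Fin n)) M]
    [IsManifold (𝓡 n) ∞ M] [T2Space M] [SigmaCompactSpace M]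
    {FA : Type*} [NormedAddCommGroup FA] [NormedSpace 𝕂 FA] [NormedSpace ℝ FA]
    [IsScalarTower ℝ 𝕂 FA] [FiniteDimensional 𝕂 FA]
    {A : M → Type*} [∀ x, AddCommGroup (A x)] [∀ x, Module 𝕂 (A x)] [∀ x, Module ℝ (A x)]
    [∀ x, IsScalarTower ℝ 𝕂 (A x)]
    [∀ x, TopologicalSpace (A x)] [TopologicalSpace (Bundle.TotalSpace FA A)]
    [FiberBundle FA A] [VectorBundle 𝕂 FA A] [VectorBundle ℝ FA A]
    [ContMDiffVectorBundle ∞ FA A (𝓡 n)]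
    {FL : Type*} [NormedAddCommGroup FL] [NormedSpace 𝕂 FL] [NormedSpace ℝ FL]
    [IsScalarTower ℝ 𝕂 FL] [FiniteDimensional 𝕂 FL]
    {L : M → Type*} [∀ x, AddCommGroup (L x)] [∀ x, Module 𝕂 (L x)] [∀ x, Module ℝ (L x)]
    [∀ x, IsScalarTower ℝ 𝕂 (L x)]
    [∀ x, TopologicalSpace (L x)] [TopologicalSpace (Bundle.TotalSpace FL L)]
    [FiberBundle FL L] [VectorBundle 𝕂 FL L] [VectorBundle ℝ FL L]
    [ContMDiffVectorBundle ∞ FL L (𝓡 n)]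
    {FB : Type*} [NormedAddCommGroup FB] [NormedSpace 𝕂 FB] [NormedSpace ℝ FB]
    [IsScalarTower ℝ 𝕂 FB] [FiniteDimensional 𝕂 FB]
    {B : M → Type*} [∀ x, AddCommGroup (B x)] [∀ x, Module 𝕂 (B x)] [∀ x, Module ℝ (B x)]
    [∀ x, IsScalarTower ℝ 𝕂 (B x)]
    [∀ x, TopologicalSpace (B x)] [TopologicalSpace (Bundle.TotalSpace FB B)]
    [FiberBundle FB B] [VectorBundle 𝕂 FB B] [VectorBundle ℝ FB B]
    [ContMDiffVectorBundle ∞ FB B (𝓡 n)]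
    (P : LiePairs.LiePair 𝕂 (𝓡 n) FA A FL L FB B)
    {𝒜 : Type*} [CommRing 𝒜] [Algebra 𝕂 𝒜] [IsLocalRing 𝒜] [IsArtinianRing 𝒜]
    (ev : 𝒜 →ₐ[𝕂] 𝕂)
    (ξ η : 𝒜 ⊗[𝕂] (LiePairs.Sec 𝕂 (𝓡 n) FA A →ₗ[LiePairs.SmoothFun 𝕂 (𝓡 n) M]
      LiePairs.Sec 𝕂 (𝓡 n) FB B))
    (hξ : P.sections.IsMaurerCartan ξ) (hη : P.sections.IsMaurerCartan η) :
    P.sections.IsInfinitesimalDeformation ev (P.sections.standard ξ) ∧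
    P.sections.IsInfinitesimalDeformation ev (P.sections.standard η) ∧
    (P.sections.GaugeEquivalent ξ η ↔
      P.sections.WeaklyIsomorphic ev (P.sections.standard ξ) (P.sections.standard η)) := by
  -- Rational scalars, needed for the exponentials, act through `𝕂`.
  let : Module ℚ (𝒜 ⊗[𝕂] LiePairs.Sec 𝕂 (𝓡 n) FL L) := Module.compHom _ (algebraMap ℚ 𝕂)
  let : Module ℚ (𝒜 ⊗[𝕂] LiePairs.SmoothFun 𝕂 (𝓡 n) M) := Module.compHom _ (algebraMap ℚ 𝕂)
  exact ⟨hξ.isInfinitesimalDeformation P.sections ev, hη.isInfinitesimalDeformation P.sections ev,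
    hξ.gaugeEquivalent_iff P.sections ev hη⟩
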